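/- Notation. For a group $G$ put $[x,y]=xyx^{-1}y^{-1}$, let $G'$ be the commutator subgroup, $G_3=[G',G]$, $\Phi(\cdot)$ the Frattini subgroup and $C_G(G')$ the centralizer of $G'$. $C_k$ is the cyclic group of order $k$, and an abelian group has type $(k_1,k_2,k_3)$ if it is isomorphic to $C_{k_1}\times C_{k_2}\times C_{k_3}$. An $\mathcal{A}_1$-group is a minimal non-abelian $p$-group, i.e. a finite non-abelian $p$-group all of whose proper subgroups are abelian; for a finite non-abelian $p$-group $G$, $p^{I_{\min}}$ and $p^{I_{\max}}$ denote the minimal and the maximal index of $\mathcal{A}_1$-subgroups of $G$. Let $M_p(n,m,1)=\langle a,b,c\mid a^{p^n}=b^{p^m}=c^p=1,\ [a,b]=c,\ [c,a]=[c,b]=1\rangle$. Theorem. Let $p$ be an odd prime, let $n\ge m\ge 2$, and let $G$ be a finite $p$-group such that $G_3\cong C_p$, $\Phi(G')G_3\cong C_p\times C_p$, $G/\Phi(G')G_3\cong M_p(n,m,1)$, and $C_G(G')/\Phi(G')G_3$ has type $(p^n,p^{m-1},p)$. Then: (1) $I_{\min}\ge 2$; in particular $G$ has no $\mathcal{A}_1$-subgroup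 of index $p$. (2) $I_{\max}\ge n$. (3) Let $w=(w_{ij})$ be any characteristic matrix of $G$, that is, a $2\times 2$ matrix over $\mathbb{F}_p$ for which there are generators $a,b$ of $G$ such that, with $c=[a,b]$ and $x=[b,c]$, one has $[a,c]=1$, $x\ne 1$, $a^{p^n}=c^{w_{11}p}x^{w_{12}}$ and $b^{p^m}=c^{w_{21}p}x^{w_{22}}$. Then $I_{\max}=2$ if and only if $n=m=2$ and one of the following holds: (i) $w_{11}=w_{12}=0$ and $w_{22}\neq 0$; (ii) $w_{11}^2-4w_{12}$ is a quadratic non-residue modulo $p$. -/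

import Mathlib

open scoped commutatorElement

/-- A group is minimal non-abelian if it is non-abelian and all its proper subgroups are abelian.
A finite `p`-group with this property is an `𝒜₁`-group. -/
def IsMinimalNonabelian (H : Type*) [Group H] : Prop :=
  (∃ x y : H, x * y ≠ y * x) ∧
    ∀ K : Subgroup H, K ≠ ⊤ → ∀ x ∈ K, ∀ y ∈ K, x * y = y * x

/-- The set of all `k` such that `G` has an `𝒜₁`-subgroup of index `p ^ k`. For a finite
non-abelian `p`-group this set is finite and non-empty, and every `𝒜₁`-subgroup contributes. -/
def a1IndexExponents (p : ℕ) (G : Type*) [Group G] : Set ℕ :=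
  {k | ∃ H : Subgroup G, IsMinimalNonabelian H ∧ H.index = p ^ k}

/-- `p ^ iMin p G` is the minimal index of `𝒜₁`-subgroups of `G`
(`G` a finite non-abelian `p`-group). -/
noncomputable def iMin (p : ℕ) (G : Type*) [Group G] : ℕ := sInf (a1IndexExponents p G)

/-- `p ^ iMax p G` is the maximal index of `𝒜₁`-subgroups of `G`
(`G` a finite non-abelian `p`-group). -/
noncomputable def iMax (p : ℕ) (G : Type*) [Group G] : ℕ := sSup (a1IndexExponents p G)

/-- The relators of `M_p(n, m, 1)`, in the generators `a = of 0`, `b = of 1`, `c = of 2`. -/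
def mRelators (p n m : ℕ) : Set (FreeGroup (Fin 3)) :=
  let a : FreeGroup (Fin 3) := FreeGroup.of 0
  let b : FreeGroup (Fin 3) := FreeGroup.of 1
  let c : FreeGroup (Fin 3) := FreeGroup.of 2
  {a ^ p ^ n, b ^ p ^ m, c ^ p, ⁅a, b⁆ * c⁻¹, ⁅c, a⁆, ⁅c, b⁆}

/-- The group `M_p(n, m, 1) =
⟨a, b, c ∣ a ^ (p ^ n) = b ^ (p ^ m) = c ^ p = 1, [a, b] = c, [c, a] = [c, b] = 1⟩`. -/
abbrev MGroup (p n m : ℕ) : Type := PresentedGroup (mRelators p n m)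

/-- `G₃ = [[G, G], G]`, the third term of the lower central series. -/
abbrev G3 (G : Type*) [Group G] : Subgroup G := (⊤ : Subgroup G).lowerCentralSeries 2

/-- `Φ(G')`, the Frattini subgroup of the commutator subgroup, as a subgroup of `G`. -/
abbrev frattiniDerived (G : Type*) [Group G] : Subgroup G :=
  (frattini (commutator G)).map (commutator G).subtype

/-- The (normal) subgroup `Φ(G') G₃` of `G`. -/
abbrev phiG3 (G : Type*) [Group G] : Subgroup G := frattiniDerived G ⊔ G3 G

/-- `C_G(G')`, the centralizer of the commutator subgroup. -/
abbrev centDerived (G : Type*) [Group G] : Subgroup G :=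
  Subgroup.centralizer (commutator G : Set G)

/-- `w` is a characteristic matrix of `G` with characteristic generators `a`, `b`: these generate
`G`, and with `c = [a, b]` and `x = [b, c]` one has `[a, c] = 1`, `x ≠ 1`,
`a ^ (p ^ n) = c ^ (w₁₁ p) x ^ w₁₂` and `b ^ (p ^ m) = c ^ (w₂₁ p) x ^ w₂₂`.
When `c ^ p, x ∈ Φ(G') G₃` and `G / Φ(G') G₃ ≅ M_p(n, m, 1)`, the images of `a`, `b`, `c` then
satisfy the defining relations of `M_p(n, m, 1)`; as they generate a quotient of that order, they
present it. -/
def IsCharacteristicMatrix {G : Type*} [Group G] (p n m : ℕ) (a b : G)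
    (w : Matrix (Fin 2) (Fin 2) (ZMod p)) : Prop :=
  let c : G := ⁅a, b⁆
  let x : G := ⁅b, c⁆
  Subgroup.closure {a, b} = ⊤ ∧ ⁅a, c⁆ = 1 ∧ x ≠ 1 ∧
    a ^ p ^ n = c ^ ((w 0 0).val * p) * x ^ (w 0 1).val ∧
    b ^ p ^ m = c ^ ((w 1 0).val * p) * x ^ (w 1 1).val

/-! Write `K` for `phiG3 G`. It is central and elementary abelian of order `p ^ 2`, `|G| = p ^ (n +
m + 3)`, and `centDerived G` has index `p`; these facts are collected in `IsMExtension`.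

An `𝒜₁`-subgroup is generated by any two of its noncommuting elements. A subgroup of index at most
`p` contains `G'`. Unless it is `centDerived G`, which is not 2-generated modulo `K`, it contains
noncommuting `h` and `d ∈ G'`; but `⟨h, d⟩` has order at most `p ^ (n + 3)`, too small when `m ≥ 2`.
Conversely, some `b` outside `centDerived G` has `b ^ p ^ m ∈ K`, and a suitable `⟨b, d⟩` is an
`𝒜₁`-subgroup of index at least `p ^ n`.

So `I_max = 2` forces `n = m = 2` and `|G| = p ^ 7`, and the question becomes whether some
`𝒜₁`-subgroup has order at most `p ^ 4`. View `K` as a plane over `𝔽_p` with basis `c ^ p`, `x`. For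
`u = a ^ i b ^ j ⋯` and `v = a ^ (p r) b ^ (p s) c ^ t ⋯`, the elements `[u, v]`, `v ^ p`, `u ^ (p ^
2)` of `K` have coordinates given by `semiconjBy_word`, `word_pow` and `word_pow_sq`. If they span
`K`, the subgroup has order at least `p ^ 5`. If they all lie on the line of `[u, v]`, then `y = j
t` and `D = i s - j r` satisfy `y² - w₁₁ y D + w₁₂ D² = 0`, whose discriminant is that of condition
(ii); (i) covers the double root zero. When both conditions fail, a root of the quadratic yields an
explicit pair `u`, `v` generating an `𝒜₁`-subgroup of order at most `p ^ 4`. -/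

section Heisenberg

/-! ### Normal forms for two generators whose commutator is central. -/

variable {G : Type*} [Group G] {u v z : G}

theorem zpow_mul_zpow_of_commutator_central (h : u * v = z * (v * u)) (hu : Commute z u)
    (hv : Commute z v) (i j : ℤ) : u ^ i * v ^ j = z ^ (i * j) * (v ^ j * u ^ i) := by
  have h1 : SemiconjBy u v (z * v) := by
    rw [SemiconjBy, h, mul_assoc]
  have h2 : u * v ^ j = z ^ j * v ^ j * u := by
    have := h1.zpow_right j
    rwa [SemiconjBy, hv.mul_zpow] at this
  have h3 : SemiconjBy (v ^ j) u (z ^ (-j) * u) := by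
    rw [SemiconjBy, mul_assoc, h2, ← mul_assoc, ← mul_assoc, ← zpow_add]
    simp
  have h4 := h3.zpow_right i
  rw [SemiconjBy, (hu.zpow_left (-j)).mul_zpow, ← zpow_mul] at h4
  rw [h4, ← mul_assoc, ← mul_assoc, ← zpow_add]
  have : i * j + -j * i = 0 := by ring
  rw [this, zpow_zero, one_mul]

/-- The multiplication law of the integral Heisenberg group: moving `v ^ j` past `u ^ r` costs `z ^
(-j r)`. -/
theorem zpow_mul_of_commutator_central (h : u * v = z * (v * u)) (hu : Commute z u)
    (hv : Commute z v) (i j k r s t : ℤ) :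
    (u ^ i * v ^ j * z ^ k) * (u ^ r * v ^ s * z ^ t) =
      u ^ (i + r) * v ^ (j + s) * z ^ (k + t - j * r) := by
  have h1 : v ^ j * u ^ r = z ^ (-(j * r)) * (u ^ r * v ^ j) := by
    rw [zpow_mul_zpow_of_commutator_central h hu hv, ← mul_assoc, ← zpow_add]
    have : -(j * r) + r * j = 0 := by ring
    rw [this, zpow_zero, one_mul]
  have cu : ∀ e f : ℤ, Commute (z ^ e) (u ^ f) := fun e f => hu.zpow_zpow e f
  have cv : ∀ e f : ℤ, Commute (z ^ e) (v ^ f) := fun e f => hv.zpow_zpow e f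
  calc (u ^ i * v ^ j * z ^ k) * (u ^ r * v ^ s * z ^ t)
      = u ^ i * v ^ j * (z ^ k * (u ^ r * v ^ s)) * z ^ t := by group
    _ = u ^ i * v ^ j * ((u ^ r * v ^ s) * z ^ k) * z ^ t := by
        rw [((cu k r).mul_right (cv k s)).eq]
    _ = u ^ i * (v ^ j * u ^ r) * v ^ s * z ^ k * z ^ t := by group
    _ = u ^ i * (z ^ (-(j * r)) * (u ^ r * v ^ j)) * v ^ s * z ^ k * z ^ t := by rw [h1]
    _ = u ^ i * (z ^ (-(j * r)) * (u ^ r * v ^ j * v ^ s)) * z ^ k * z ^ t := by group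
    _ = u ^ i * ((u ^ r * v ^ j * v ^ s) * z ^ (-(j * r))) * z ^ k * z ^ t := by
        rw [(((cu _ r).mul_right (cv _ j)).mul_right (cv (-(j * r)) s)).eq]
    _ = u ^ (i + r) * v ^ (j + s) * z ^ (k + t - j * r) := by group

theorem exists_zpow_eq_of_commutator_central (h : u * v = z * (v * u)) (hu : Commute z u)
    (hv : Commute z v) (i j k s : ℤ) :
    ∃ t : ℤ, (u ^ i * v ^ j * z ^ k) ^ s = u ^ (i * s) * v ^ (j * s) * z ^ t := by
  induction s using Int.induction_on with
  | zero => exact ⟨0, by simp⟩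
  | succ n ih =>
    obtain ⟨t, ht⟩ := ih
    refine ⟨t + k - (j * n) * i, ?_⟩
    rw [zpow_add, zpow_one, ht, zpow_mul_of_commutator_central h hu hv]
    simp only [mul_add, mul_one]
  | pred n ih =>
    obtain ⟨t, ht⟩ := ih
    refine ⟨t - k + (j * (-n - 1)) * i, ?_⟩
    rw [zpow_sub, zpow_one, ht, mul_inv_eq_iff_eq_mul, zpow_mul_of_commutator_central h hu hv]
    congr 2 <;> ring_nf

theorem exists_eq_of_mem_closure_pair (h : u * v = z * (v * u)) (hu : Commute z u)
    (hv : Commute z v) {g : G} (hg : g ∈ Subgroup.closure {u, v}) :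
    ∃ i j k : ℤ, g = u ^ i * v ^ j * z ^ k := by
  induction hg using Subgroup.closure_induction with
  | mem x hx =>
    rcases hx with rfl | rfl
    · exact ⟨1, 0, 0, by rw [zpow_zero, zpow_one, zpow_zero, mul_one, mul_one]⟩
    · exact ⟨0, 1, 0, by rw [zpow_zero, zpow_one, zpow_zero, one_mul, mul_one]⟩
  | one => exact ⟨0, 0, 0, by simp⟩
  | mul x y _ _ hx hy =>
    obtain ⟨i, j, k, rfl⟩ := hx
    obtain ⟨r, s, t, rfl⟩ := hy
    exact ⟨_, _, _, zpow_mul_of_commutator_central h hu hv i j k r s t⟩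
  | inv x _ hx =>
    obtain ⟨i, j, k, rfl⟩ := hx
    obtain ⟨t, ht⟩ := exists_zpow_eq_of_commutator_central h hu hv i j k (-1)
    rw [zpow_neg_one] at ht
    exact ⟨_, _, t, ht⟩

theorem mul_pow_of_commutator_central (h : u * v = z * (v * u)) (hu : Commute z u)
    (hv : Commute z v) (N : ℕ) : (v * u) ^ N = z ^ N.choose 2 * (v ^ N * u ^ N) := by
  induction N with
  | zero => simp
  | succ N ih =>
    have h1 : u ^ N * v = z ^ N * (v * u ^ N) := by
      have := zpow_mul_zpow_of_commutator_central h hu hv N 1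
      rwa [zpow_one, mul_one, zpow_natCast, zpow_natCast] at this
    rw [pow_succ, ih, Nat.choose_succ_succ' N 1, Nat.choose_one_right]
    calc z ^ N.choose 2 * (v ^ N * u ^ N) * (v * u)
        = z ^ N.choose 2 * v ^ N * (u ^ N * v) * u := by group
      _ = z ^ N.choose 2 * (v ^ N * z ^ N) * v * u ^ N * u := by rw [h1]; group
      _ = z ^ N.choose 2 * (z ^ N * v ^ N) * v * u ^ N * u := by rw [(hv.pow_pow N N).eq]
      _ = z ^ (N + N.choose 2) * (v ^ (N + 1) * u ^ (N + 1)) := by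
        rw [add_comm N, pow_add, pow_succ v, pow_succ u]; group

theorem card_closure_pair_le (h : u * v = z * (v * u)) (hu : Commute z u) (hv : Commute z v)
    {A B C : ℕ} (hA : 0 < A) (hB : 0 < B) (hC : 0 < C) (huA : u ^ A ∈ Subgroup.zpowers z)
    (hvB : v ^ B ∈ Subgroup.zpowers z) (hzC : z ^ C = 1) :
    Nat.card (Subgroup.closure {u, v}) ≤ A * B * C := by
  obtain ⟨α, hα⟩ := Subgroup.mem_zpowers_iff.1 huA
  obtain ⟨β, hβ⟩ := Subgroup.mem_zpowers_iff.1 hvB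
  have key : ∀ g ∈ Subgroup.closure {u, v},
      ∃ x : Fin A × Fin B × Fin C, u ^ (x.1 : ℕ) * v ^ (x.2.1 : ℕ) * z ^ (x.2.2 : ℕ) = g := by
    intro g hg
    obtain ⟨i, j, k, rfl⟩ := exists_eq_of_mem_closure_pair h hu hv hg
    have hlt : ∀ {D : ℕ} (_ : 0 < D) (e : ℤ), ((e % D).toNat : ℤ) = e % D ∧ (e % D).toNat < D := by
      intro D hD e
      have := Int.emod_nonneg e (Int.natCast_ne_zero.2 hD.ne')
      have := Int.emod_lt_of_pos e (Int.natCast_pos.2 hD)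
      omega
    -- Reducing `i` modulo `A` and `j` modulo `B` produces carries, which become powers of `z`
    -- because `u ^ A = z ^ α` and `v ^ B = z ^ β`.
    set k' : ℤ := α * (i / A) + β * (j / B) + k with hk'
    refine ⟨⟨⟨_, (hlt hA i).2⟩, ⟨_, (hlt hB j).2⟩, ⟨_, (hlt hC k').2⟩⟩, ?_⟩
    have e1 : u ^ i = u ^ (i % A).toNat * z ^ (α * (i / A)) := by
      rw [zpow_mul, hα, ← zpow_natCast, (hlt hA i).1, ← zpow_natCast, ← zpow_mul, ← zpow_add,
        Int.emod_add_mul_ediv]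
    have e2 : v ^ j = v ^ (j % B).toNat * z ^ (β * (j / B)) := by
      rw [zpow_mul, hβ, ← zpow_natCast, (hlt hB j).1, ← zpow_natCast, ← zpow_mul, ← zpow_add,
        Int.emod_add_mul_ediv]
    have e3 : z ^ k' = z ^ (k' % C).toNat := by
      conv_lhs => rw [← Int.emod_add_mul_ediv k' C]
      rw [zpow_add, zpow_mul, zpow_natCast, hzC, one_zpow, mul_one, ← (hlt hC k').1, zpow_natCast]
      simp [(hlt hC k').1]
    simp only []
    rw [← e3, hk', zpow_add, zpow_add, e1, e2]
    have c1 := (hv.pow_right (j % B).toNat).zpow_left (α * (i / A))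
    calc u ^ (i % A).toNat * v ^ (j % B).toNat * (z ^ (α * (i / A)) * z ^ (β * (j / B)) * z ^ k)
        = u ^ (i % A).toNat * (v ^ (j % B).toNat * z ^ (α * (i / A))) * z ^ (β * (j / B)) * z ^ k := by
          simp only [mul_assoc]
      _ = _ := by rw [← c1.eq]; simp only [mul_assoc]
  let f : Fin A × Fin B × Fin C → G :=
    fun x => u ^ (x.1 : ℕ) * v ^ (x.2.1 : ℕ) * z ^ (x.2.2 : ℕ)
  have hsub : (Subgroup.closure {u, v} : Set G) ⊆ Set.range f := fun g hg => key g hg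
  calc Nat.card (Subgroup.closure {u, v}) ≤ Nat.card (Set.range f) :=
        Nat.card_mono (Set.finite_range f) hsub
    _ ≤ Nat.card (Fin A × Fin B × Fin C) := Finite.card_range_le f
    _ = A * B * C := by simp [mul_assoc]

end Heisenberg

/-! ### Minimal non-abelian subgroups and general facts on `p`-groups. -/

section PGroup

variable {p : ℕ} {G : Type*} [Group G]

theorem IsPGroup.mem_of_zpow_mem [Fact p.Prime] (hG : IsPGroup p G) {H : Subgroup G} {g : G}
    {d : ℤ} (hd : ¬ (p : ℤ) ∣ d) (hg : g ^ d ∈ H) : g ∈ H := by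
  obtain ⟨k, hk⟩ := hG g
  have hp : Prime (p : ℤ) := Nat.prime_iff_prime_int.1 Fact.out
  obtain ⟨r, s, hrs⟩ : IsCoprime d ((p : ℤ) ^ k) :=
    IsCoprime.pow_right ((hp.coprime_iff_not_dvd.2 hd).symm)
  have : g = (g ^ d) ^ r := by
    conv_lhs => rw [← zpow_one g, ← hrs, zpow_add, mul_comm r, zpow_mul, mul_comm s, zpow_mul g _ s]
    have : g ^ ((p : ℤ) ^ k) = 1 := by exact_mod_cast hk
    simp [this]
  rw [this]
  exact H.zpow_mem hg r

/-- The commutator of two elements is `z` to the determinant of their exponent vectors. If they do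
not commute, the determinant is prime to `p`, so they generate `z` and then, by Cramer's rule, `u`
and `v`. -/
theorem isMinimalNonabelian_closure_pair [Fact p.Prime] (hG : IsPGroup p G) {u v : G}
    (hu : Commute ⁅u, v⁆ u) (hv : Commute ⁅u, v⁆ v) (h1 : ⁅u, v⁆ ≠ 1) (hpow : ⁅u, v⁆ ^ p = 1) :
    IsMinimalNonabelian (Subgroup.closure {u, v}) := by
  set z := ⁅u, v⁆ with hz
  have h : u * v = z * (v * u) := by rw [hz, commutatorElement_def]; group
  set H := Subgroup.closure {u, v} with hH
  have huH : u ∈ H := Subgroup.subset_closure (by simp)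
  have hvH : v ∈ H := Subgroup.subset_closure (by simp)
  refine ⟨⟨⟨u, huH⟩, ⟨v, hvH⟩, ?_⟩, ?_⟩
  · intro h2
    apply h1
    rw [hz, commutatorElement_eq_one_iff_mul_comm]
    simpa using h2
  · intro K hK x hx y hy
    by_contra hxy
    apply hK
    set J := K.map H.subtype with hJ
    suffices hJH : H ≤ J by
      rw [eq_top_iff]
      intro g _
      obtain ⟨g', hg', e⟩ := hJH g.2
      have : g' = g := Subtype.ext e
      exact this ▸ hg'
    have hxJ : (x : G) ∈ J := ⟨x, hx, rfl⟩
    have hyJ : (y : G) ∈ J := ⟨y, hy, rfl⟩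
    have hne : (x : G) * y ≠ y * x := fun e => hxy (Subtype.ext e)
    obtain ⟨i, j, k, ex⟩ := exists_eq_of_mem_closure_pair h hu hv x.2
    obtain ⟨r, s, t, ey⟩ := exists_eq_of_mem_closure_pair h hu hv y.2
    have e1 : (x : G) * y = u ^ (i + r) * v ^ (j + s) * z ^ (k + t - j * r) := by
      rw [ex, ey, zpow_mul_of_commutator_central h hu hv]
    have e2 : (y : G) * x = u ^ (i + r) * v ^ (j + s) * z ^ (k + t - s * i) := by
      rw [ex, ey, zpow_mul_of_commutator_central h hu hv, add_comm r, add_comm s, add_comm t]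
    have e3 : ((y : G) * x)⁻¹ * (x * y) = z ^ (i * s - j * r) := by
      rw [e1, e2]; group
    have hd : ¬ (p : ℤ) ∣ i * s - j * r := by
      rintro ⟨d, hd⟩
      rw [hd, zpow_mul, zpow_natCast, hpow, one_zpow, inv_mul_eq_one] at e3
      exact hne e3.symm
    have hzJ : z ∈ J := by
      refine hG.mem_of_zpow_mem hd ?_
      rw [← e3]
      exact J.mul_mem (J.inv_mem (J.mul_mem hyJ hxJ)) (J.mul_mem hxJ hyJ)
    have comb : ∀ e f : ℤ, ∃ l : ℤ, (x : G) ^ e * (y : G) ^ f =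
        u ^ (i * e + r * f) * v ^ (j * e + s * f) * z ^ l := by
      intro e f
      obtain ⟨l1, h1⟩ := exists_zpow_eq_of_commutator_central h hu hv i j k e
      obtain ⟨l2, h2⟩ := exists_zpow_eq_of_commutator_central h hu hv r s t f
      rw [ex, ey, h1, h2, zpow_mul_of_commutator_central h hu hv]
      exact ⟨_, rfl⟩
    have huJ : u ∈ J := by
      refine hG.mem_of_zpow_mem hd ?_
      obtain ⟨l, hl⟩ := comb s (-j)
      have e0 : j * s + s * -j = 0 := by ring
      have e4 : u ^ (i * s - j * r) = (x : G) ^ s * (y : G) ^ (-j) * (z ^ l)⁻¹ := by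
        rw [hl, e0]; group
      rw [e4]
      exact J.mul_mem (J.mul_mem (J.zpow_mem hxJ _) (J.zpow_mem hyJ _))
        (J.inv_mem (J.zpow_mem hzJ _))
    have hvJ : v ∈ J := by
      refine hG.mem_of_zpow_mem hd ?_
      obtain ⟨l, hl⟩ := comb (-r) i
      have e0 : i * -r + r * i = 0 := by ring
      have e4 : v ^ (i * s - j * r) = (x : G) ^ (-r) * (y : G) ^ i * (z ^ l)⁻¹ := by
        rw [hl, e0]; group
      rw [e4]
      exact J.mul_mem (J.mul_mem (J.zpow_mem hxJ _) (J.zpow_mem hyJ _))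
        (J.inv_mem (J.zpow_mem hzJ _))
    rw [hH, Subgroup.closure_le]
    rintro g (rfl | rfl)
    · exact huJ
    · exact hvJ

theorem IsMinimalNonabelian.eq_closure_pair {H : Subgroup G} (hH : IsMinimalNonabelian H)
    {x y : G} (hx : x ∈ H) (hy : y ∈ H) (hxy : x * y ≠ y * x) :
    H = Subgroup.closure {x, y} := by
  have hle : Subgroup.closure {x, y} ≤ H := by
    rw [Subgroup.closure_le]
    rintro g (rfl | rfl)
    · exact hx
    · exact hy
  by_contra hne
  have hK : (Subgroup.closure {x, y}).subgroupOf H ≠ ⊤ := by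
    intro h
    exact hne (le_antisymm (Subgroup.subgroupOf_eq_top.1 h) hle)
  apply hxy
  have := hH.2 _ hK ⟨x, hx⟩ (Subgroup.mem_subgroupOf.2 (Subgroup.subset_closure (by simp)))
    ⟨y, hy⟩ (Subgroup.mem_subgroupOf.2 (Subgroup.subset_closure (by simp)))
  simpa using this

theorem commutator_le_of_closure_pair {a b : G} (hab : Subgroup.closure {a, b} = ⊤)
    {N : Subgroup G} [N.Normal] (h : ⁅a, b⁆ ∈ N) : commutator G ≤ N := by
  rw [← Subgroup.Normal.quotient_commutative_iff_commutator_le]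
  have hc : (a : G ⧸ N) * b = b * a := by
    rw [← commutatorElement_eq_one_iff_mul_comm]
    exact (QuotientGroup.eq_one_iff _).2 h
  have htop : Subgroup.closure {(a : G ⧸ N), (b : G ⧸ N)} = ⊤ := by
    have := MonoidHom.map_closure (QuotientGroup.mk' N) {a, b}
    rw [hab, Subgroup.map_top_of_surjective _ (QuotientGroup.mk'_surjective N), Set.image_pair]
      at this
    exact this.symm
  have := Subgroup.isMulCommutative_closure (k := {(a : G ⧸ N), (b : G ⧸ N)}) (by
    rintro x (rfl | rfl) y (rfl | rfl)
    · rfl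
    · exact hc
    · exact hc.symm
    · rfl)
  rw [htop] at this
  refine ⟨⟨fun x y => ?_⟩⟩
  exact congrArg Subtype.val (this.1.1 ⟨x, trivial⟩ ⟨y, trivial⟩)

/-- A maximal subgroup containing `H` would be normal with a nontrivial perfect quotient, impossible
for a nilpotent group. -/
theorem eq_top_of_sup_commutator_eq_top [Group.IsNilpotent G] [Finite G] {H : Subgroup G}
    (h : H ⊔ commutator G = ⊤) : H = ⊤ := by
  rcases eq_top_or_exists_le_coatom H with h1 | ⟨M, hM, hHM⟩
  · exact h1
  · exfalso
    have : M.Normal :=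
      Subgroup.NormalizerCondition.normal_of_coatom M Group.normalizerCondition_of_isNilpotent hM
    have hMc : M ⊔ commutator G = ⊤ := top_le_iff.1 (h ▸ sup_le_sup_right hHM _)
    have : Nontrivial (G ⧸ M) := QuotientGroup.nontrivial_iff.2 hM.1
    have hs := Group.IsSolvable.commutator_lt_top_of_nontrivial (G ⧸ M)
    have e : (commutator G).map (QuotientGroup.mk' M) = commutator (G ⧸ M) := by
      rw [commutator_def, Subgroup.map_commutator,
        Subgroup.map_top_of_surjective _ (QuotientGroup.mk'_surjective M), commutator_def]
    have e2 := congrArg (Subgroup.map (QuotientGroup.mk' M)) hMc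
    rw [Subgroup.map_sup, e, Subgroup.map_top_of_surjective _ (QuotientGroup.mk'_surjective M),
      QuotientGroup.map_mk'_self, bot_sup_eq] at e2
    exact hs.ne e2

/-- If `[N, G]` were not trivial it would equal `N`, and `N` would lie in every term of the lower
central series. -/
theorem IsPGroup.le_center_of_card_eq [Fact p.Prime] [Finite G] (hG : IsPGroup p G)
    {N : Subgroup G} [N.Normal] (hN : Nat.card N = p) : N ≤ Subgroup.center G := by
  have hp : p.Prime := Fact.out
  have := hG.isNilpotent
  rw [← Subgroup.commutator_top_right_eq_bot_iff_le_center]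
  have hle : ⁅N, (⊤ : Subgroup G)⁆ ≤ N := Subgroup.commutator_le_left N ⊤
  rcases (Nat.dvd_prime hp).1 (hN ▸ Subgroup.card_dvd_of_le hle) with h | h
  · exact Subgroup.card_eq_one.1 h
  · exfalso
    have heq : ⁅N, (⊤ : Subgroup G)⁆ = N := Subgroup.eq_of_le_of_card_ge hle (by rw [h, hN])
    have hlcs : ∀ k, N ≤ (⊤ : Subgroup G).lowerCentralSeries k := by
      intro k
      induction k with
      | zero => exact le_top
      | succ k ih =>
        rw [Subgroup.lowerCentralSeries_succ]
        exact heq.ge.trans (Subgroup.commutator_mono ih le_rfl)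
    obtain ⟨k, hk⟩ := Subgroup.nilpotent_iff_lowerCentralSeries.1 ‹Group.IsNilpotent G›
    have h0 := hlcs k
    rw [hk, le_bot_iff] at h0
    rw [h0, Subgroup.card_bot] at hN
    exact hp.one_lt.ne hN

theorem IsPGroup.pow_succ_le_card [Fact p.Prime] [Finite G] (hG : IsPGroup p G)
    {A B : Subgroup G} (h : A < B) {k : ℕ} (hA : p ^ k ≤ Nat.card A) :
    p ^ (k + 1) ≤ Nat.card B := by
  have hp : 1 < p := (Fact.out : p.Prime).one_lt
  obtain ⟨α, hα⟩ := IsPGroup.iff_card.1 (hG.to_subgroup A)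
  obtain ⟨β, hβ⟩ := IsPGroup.iff_card.1 (hG.to_subgroup B)
  have h1 : Nat.card A < Nat.card B := by
    refine lt_of_le_of_ne (Subgroup.card_le_of_le h.le) fun e => h.ne ?_
    exact Subgroup.eq_of_le_of_card_ge h.le e.ge
  rw [hα] at hA h1
  rw [hβ] at h1 ⊢
  have := (Nat.pow_lt_pow_iff_right hp).1 h1
  have := (Nat.pow_le_pow_iff_right hp).1 hA
  exact Nat.pow_le_pow_right hp.le (by omega)

end PGroup

/-! ### Two-generator groups modulo `G'` and `G₃`. -/

section Pairs

variable {G : Type*} [Group G]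

theorem exists_eq_zpow_mul_zpow_mul_commutator {a b : G} (hab : Subgroup.closure {a, b} = ⊤)
    (g : G) : ∃ i j : ℤ, ∃ d ∈ commutator G, g = a ^ i * b ^ j * d := by
  have h1 : (Abelianization.of g) ∈
      Subgroup.closure {Abelianization.of a, Abelianization.of b} := by
    rw [← Set.image_pair, ← MonoidHom.map_closure, hab]
    exact ⟨g, trivial, rfl⟩
  obtain ⟨i, j, h⟩ := Subgroup.mem_closure_pair.1 h1
  refine ⟨i, j, (a ^ i * b ^ j)⁻¹ * g, ?_, by group⟩
  rw [← Abelianization.ker_of, MonoidHom.mem_ker, map_mul, map_inv, ← h]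
  simp

theorem commutator_top_eq_G3 : ⁅commutator G, (⊤ : Subgroup G)⁆ = G3 G := by
  rw [G3, Subgroup.lowerCentralSeries_succ, Subgroup.top_lowerCentralSeries_one]

theorem G3_le_commutator : G3 G ≤ commutator G := by
  rw [← commutator_top_eq_G3]
  exact Subgroup.commutator_le_left _ _

theorem phiG3_le_commutator : phiG3 G ≤ commutator G :=
  sup_le (Subgroup.map_subtype_le _) G3_le_commutator

theorem commutatorElement_mem_G3 {d : G} (hd : d ∈ commutator G) (g : G) : ⁅g, d⁆ ∈ G3 G := by
  rw [← commutator_top_eq_G3, Subgroup.commutator_comm]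
  exact Subgroup.commutator_mem_commutator trivial hd

theorem commutatorElement_mem_commutator (g h : G) : ⁅g, h⁆ ∈ commutator G :=
  Subgroup.commutator_mem_commutator trivial trivial

/-- `⟨c⟩ G₃` is normal, since commutators of its elements with `G` fall into `G₃`, and the quotient
by it is abelian. -/
theorem exists_eq_zpow_mul_of_mem_commutator {a b : G} (hab : Subgroup.closure {a, b} = ⊤)
    {g : G} (hg : g ∈ commutator G) : ∃ i : ℤ, ∃ y ∈ G3 G, g = ⁅a, b⁆ ^ i * y := by
  have hN : Subgroup.zpowers ⁅a, b⁆ ⊔ G3 G ≤ commutator G :=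
    sup_le (by simpa using commutatorElement_mem_commutator a b) G3_le_commutator
  have : (Subgroup.zpowers ⁅a, b⁆ ⊔ G3 G).Normal := by
    rw [← Subgroup.commutator_top_right_le_iff]
    exact ((Subgroup.commutator_mono hN le_rfl).trans commutator_top_eq_G3.le).trans le_sup_right
  have h := commutator_le_of_closure_pair hab
    (le_sup_left (a := Subgroup.zpowers ⁅a, b⁆) (b := G3 G) (Subgroup.mem_zpowers _)) hg
  obtain ⟨_, ⟨i, rfl⟩, y, hy, rfl⟩ := Subgroup.mem_sup_of_normal_right.1 h
  exact ⟨i, y, hy, rfl⟩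

theorem card_le_card_map_mk_mul [Finite G] (H K : Subgroup G) [K.Normal] :
    Nat.card H ≤ Nat.card (H.map (QuotientGroup.mk' K)) * Nat.card K := by
  rw [← Subgroup.relIndex_ker, QuotientGroup.ker_mk', ← Subgroup.inf_relIndex_right,
    ← Subgroup.relIndex_bot_left H,
    ← Subgroup.relIndex_mul_relIndex ⊥ (K ⊓ H) H bot_le inf_le_right, Subgroup.relIndex_bot_left,
    mul_comm]
  exact Nat.mul_le_mul_left _ (Subgroup.card_le_of_le inf_le_left)

theorem commutator_le_of_index_prime [Finite G] [Group.IsNilpotent G] {p : ℕ} (hp : p.Prime)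
    {H : Subgroup G} (hH : H.index = p) : commutator G ≤ H := by
  have hdvd : (H ⊔ commutator G).index ∣ p := hH ▸ Subgroup.index_dvd_of_le le_sup_left
  rcases (Nat.dvd_prime hp).1 hdvd with h | h
  · rw [eq_top_of_sup_commutator_eq_top (Subgroup.index_eq_one.1 h), Subgroup.index_top] at hH
    exact absurd hH hp.one_lt.ne
  · have := Subgroup.eq_of_le_of_card_ge (le_sup_left (a := H) (b := commutator G)) (by
      have h1 := H.card_mul_index
      have h2 := (H ⊔ commutator G).card_mul_index
      rw [hH] at h1
      rw [h, ← h1] at h2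
      exact (Nat.eq_of_mul_eq_mul_right hp.pos h2).le)
    rw [this]
    exact le_sup_right

/-- In class two the error term is a commutator to the power `p.choose 2`, a multiple of `p` for odd
`p`. -/
theorem mul_pow_prime_pow_of_commutator {p : ℕ} (hp : p.Prime) (hodd : Odd p)
    (hc : ∀ g h : G, ⁅g, h⁆ ∈ Subgroup.center G) (hpow : ∀ g h : G, ⁅g, h⁆ ^ p = 1)
    (g h : G) (k : ℕ) : (g * h) ^ p ^ k = g ^ p ^ k * h ^ p ^ k := by
  have key : ∀ g h : G, (g * h) ^ p = g ^ p * h ^ p := by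
    intro g h
    have hz := Subgroup.mem_center_iff.1 (hc h g)
    rw [mul_pow_of_commutator_central (z := ⁅h, g⁆) (by rw [commutatorElement_def]; group)
      (hz h).symm (hz g).symm]
    have h2 : p ∣ p.choose 2 := hp.dvd_choose_self two_ne_zero
      (lt_of_le_of_ne hp.two_le fun e => by rw [← e] at hodd; exact absurd hodd (by decide))
    obtain ⟨q, hq⟩ := h2
    rw [hq, pow_mul, hpow, one_pow, one_mul]
  induction k with
  | zero => simp
  | succ k ih => rw [pow_succ, pow_mul, ih, key, ← pow_mul, ← pow_mul]

end Pairs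

/-- The consequences of the hypotheses on `Φ(G') G₃` that the index computations use. -/
structure IsMExtension (p n m : ℕ) (G : Type*) [Group G] : Prop where
  isPGroup : IsPGroup p G
  card_G3 : Nat.card (G3 G) = p
  card_phiG3 : Nat.card (phiG3 G) = p ^ 2
  G3_le_center : G3 G ≤ Subgroup.center G
  phiG3_le_center : phiG3 G ≤ Subgroup.center G
  pow_eq_one : ∀ k ∈ phiG3 G, k ^ p = 1
  not_commutator_le : ¬ commutator G ≤ phiG3 G
  pow_mem_of_mem_commutator : ∀ d ∈ commutator G, d ^ p ∈ phiG3 G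
  index_centDerived : (centDerived G).index = p
  card_eq : Nat.card G = p ^ (n + m + 3)
  mul_pow_mem : ∀ (g h : G) (k : ℕ), ((g ^ p ^ k * h ^ p ^ k)⁻¹ * (g * h) ^ p ^ k) ∈ phiG3 G
  pow_mem : ∀ g : G, g ^ p ^ n ∈ phiG3 G
  exists_notMem : ∃ b : G, b ∉ centDerived G ∧ b ^ p ^ m ∈ phiG3 G

/-! ### Deriving `IsMExtension` from the hypotheses. -/

section Structure

variable {p n m : ℕ} {G : Type*} [Group G]

theorem exists_generators_of_mulEquiv_MGroup [Finite G] (hG : Group.IsNilpotent G)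
    (e : (G ⧸ phiG3 G) ≃* MGroup p n m) :
    ∃ a b : G, Subgroup.closure {a, b} = ⊤ ∧ a ^ p ^ n ∈ phiG3 G ∧ b ^ p ^ m ∈ phiG3 G ∧
      ⁅a, b⁆ ^ p ∈ phiG3 G := by
  obtain ⟨a, ha⟩ := QuotientGroup.mk'_surjective (phiG3 G) (e.symm (PresentedGroup.of 0))
  obtain ⟨b, hb⟩ := QuotientGroup.mk'_surjective (phiG3 G) (e.symm (PresentedGroup.of 1))
  have rel : ∀ r ∈ mRelators p n m, PresentedGroup.mk (mRelators p n m) r = 1 :=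
    fun r hr => PresentedGroup.one_of_mem hr
  have r1 := rel (FreeGroup.of 0 ^ p ^ n) (by simp [mRelators])
  have r2 := rel (FreeGroup.of 1 ^ p ^ m) (by simp [mRelators])
  have r3 := rel (FreeGroup.of 2 ^ p) (by simp [mRelators])
  have r4 := rel (⁅(FreeGroup.of 0 : FreeGroup (Fin 3)), FreeGroup.of 1⁆ * (FreeGroup.of 2)⁻¹)
    (by simp [mRelators])
  rw [map_pow] at r1 r2 r3
  rw [map_mul, map_inv, map_commutatorElement, mul_inv_eq_one] at r4
  change (PresentedGroup.of 0 : MGroup p n m) ^ p ^ n = 1 at r1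
  change (PresentedGroup.of 1 : MGroup p n m) ^ p ^ m = 1 at r2
  change (PresentedGroup.of 2 : MGroup p n m) ^ p = 1 at r3
  change ⁅(PresentedGroup.of 0 : MGroup p n m), PresentedGroup.of 1⁆ = PresentedGroup.of 2 at r4
  have hker : ∀ g : G, QuotientGroup.mk' (phiG3 G) g = 1 → g ∈ phiG3 G :=
    fun g hg => (QuotientGroup.eq_one_iff g).1 hg
  refine ⟨a, b, ?_, hker _ ?_, hker _ ?_, hker _ ?_⟩
  · apply eq_top_of_sup_commutator_eq_top
    rw [eq_top_iff]
    refine le_trans ?_ (sup_le_sup_left phiG3_le_commutator _)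
    have htop : Subgroup.closure {(PresentedGroup.of 0 : MGroup p n m), PresentedGroup.of 1}
        = ⊤ := by
      rw [eq_top_iff, ← PresentedGroup.closure_range_of, Subgroup.closure_le]
      rintro _ ⟨i, rfl⟩
      have m0 : (PresentedGroup.of 0 : MGroup p n m) ∈
        Subgroup.closure {(PresentedGroup.of 0 : MGroup p n m), PresentedGroup.of 1} :=
          Subgroup.subset_closure (by simp)
      have m1 : (PresentedGroup.of 1 : MGroup p n m) ∈
        Subgroup.closure {(PresentedGroup.of 0 : MGroup p n m), PresentedGroup.of 1} :=
          Subgroup.subset_closure (by simp)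
      fin_cases i
      · exact m0
      · exact m1
      · change (PresentedGroup.of 2 : MGroup p n m) ∈ Subgroup.closure _
        rw [← r4, commutatorElement_def]
        exact mul_mem (mul_mem (mul_mem m0 m1) (inv_mem m0)) (inv_mem m1)
    have hmap : (Subgroup.closure {a, b}).map (QuotientGroup.mk' (phiG3 G)) = ⊤ := by
      rw [MonoidHom.map_closure, Set.image_pair, ha, hb, ← Set.image_pair (e.symm)]
      have := MonoidHom.map_closure e.symm.toMonoidHom {PresentedGroup.of 0, PresentedGroup.of 1}
      rw [htop, Subgroup.map_top_of_surjective _ e.symm.surjective] at this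
      exact this.symm
    intro g _
    obtain ⟨g', hg', h⟩ : QuotientGroup.mk' (phiG3 G) g ∈
      (Subgroup.closure {a, b}).map (QuotientGroup.mk' (phiG3 G)) := hmap ▸ trivial
    have : g = g' * (g'⁻¹ * g) := by group
    rw [this]
    refine Subgroup.mul_mem_sup hg' ?_
    exact QuotientGroup.eq.1 h
  · rw [map_pow, ha, ← map_pow, r1, map_one]
  · rw [map_pow, hb, ← map_pow, r2, map_one]
  · rw [map_pow, map_commutatorElement, ha, hb, ← map_commutatorElement, r4, ← map_pow, r3, map_one]

/-- Frattini elements are non-generators: `G' = Φ(G') G₃` would give `G' = G₃`. -/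
theorem not_commutator_le_phiG3 [Finite G] (h : Nat.card (G3 G) < Nat.card (phiG3 G)) :
    ¬ commutator G ≤ phiG3 G := by
  intro hle
  have heq : phiG3 G = commutator G := le_antisymm phiG3_le_commutator hle
  have htop : (G3 G).subgroupOf (commutator G) ⊔ frattini (commutator G) = ⊤ := by
    apply Subgroup.map_injective (commutator G).subtype_injective
    rw [Subgroup.map_sup, Subgroup.subgroupOf_map_subtype, inf_eq_left.2 G3_le_commutator,
      ← MonoidHom.range_eq_map, Subgroup.range_subtype, sup_comm]
    exact heq
  have := Subgroup.subgroupOf_eq_top.1 (frattini_nongenerating htop)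
  exact absurd (Subgroup.card_le_of_le (heq.le.trans this)) (not_le.2 h)

/-- Since `G₃` is central, `g ↦ [g, c]` is a homomorphism to `G₃` with kernel `C_G(G')`. It is
nontrivial because `G₃` is. -/
theorem index_centDerived_eq [Fact p.Prime] (hG3 : Nat.card (G3 G) = p)
    (hcen : G3 G ≤ Subgroup.center G) {a b : G} (hab : Subgroup.closure {a, b} = ⊤) :
    (centDerived G).index = p := by
  have hp : p.Prime := Fact.out
  set c := ⁅a, b⁆ with hc
  have hcG : c ∈ commutator G := commutatorElement_mem_commutator a b
  let φ : G →* G3 G :=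
    { toFun := fun g => ⟨⁅g, c⁆, commutatorElement_mem_G3 hcG g⟩
      map_one' := Subtype.ext (commutatorElement_one_left c)
      map_mul' := fun g h => by
        apply Subtype.ext
        have hz := Subgroup.mem_center_iff.1 (hcen (commutatorElement_mem_G3 hcG h))
        change ⁅g * h, c⁆ = ⁅g, c⁆ * ⁅h, c⁆
        rw [commutatorElement_mul_left_eq_conj_mul, hz g, mul_inv_cancel_right, hz] }
  have hker : φ.ker = centDerived G := by
    ext g
    rw [MonoidHom.mem_ker, Subgroup.mem_centralizer_iff]
    have : φ g = 1 ↔ g * c = c * g := by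
      rw [← commutatorElement_eq_one_iff_mul_comm]
      exact Subtype.ext_iff
    rw [this]
    constructor
    · intro hgc d hd
      obtain ⟨i, y, hy, rfl⟩ := exists_eq_zpow_mul_of_mem_commutator hab hd
      have h1 : Commute g (c ^ i) := Commute.zpow_right hgc i
      exact (h1.mul_right (Subgroup.mem_center_iff.1 (hcen hy) g)).eq.symm
    · intro h
      exact (h c hcG).symm
  have hdvd : (centDerived G).index ∣ p := by
    rw [← hker, Subgroup.index_ker, ← hG3]
    exact Subgroup.card_subgroup_dvd_card _
  rcases (Nat.dvd_prime hp).1 hdvd with h | h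
  · exfalso
    rw [Subgroup.index_eq_one, ← top_le_iff] at h
    have hbot : G3 G = ⊥ := by
      rw [← commutator_top_eq_G3, Subgroup.commutator_comm,
        Subgroup.commutator_eq_bot_iff_le_centralizer]
      exact h
    rw [hbot, Subgroup.card_bot] at hG3
    exact hp.one_lt.ne hG3
  · exact h

theorem card_eq_of_centDerived [Finite G] [Fact p.Prime] (hm : 2 ≤ m)
    (hK : Nat.card (phiG3 G) = p ^ 2) (hle : phiG3 G ≤ centDerived G)
    (hindex : (centDerived G).index = p)
    (hC : Nonempty ((centDerived G ⧸ (phiG3 G).subgroupOf (centDerived G)) ≃*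
      Multiplicative (ZMod (p ^ n) × ZMod (p ^ (m - 1)) × ZMod p))) :
    Nat.card G = p ^ (n + m + 3) := by
  obtain ⟨e⟩ := hC
  obtain ⟨m, rfl⟩ := Nat.exists_eq_add_of_le' (show 1 ≤ m by omega)
  rw [← (centDerived G).card_mul_index, hindex,
    Subgroup.card_eq_card_quotient_mul_card_subgroup ((phiG3 G).subgroupOf (centDerived G)),
    Nat.card_congr e.toEquiv, Nat.card_congr (Subgroup.subgroupOfEquivOfLe hle).toEquiv, hK,
    Nat.card_congr Multiplicative.toAdd]
  simp only [Nat.card_prod, Nat.card_zmod, Nat.add_sub_cancel]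
  ring

theorem exists_pow_notMem_phiG3 [Fact p.Prime] (hn : 1 ≤ n)
    (hC : Nonempty ((centDerived G ⧸ (phiG3 G).subgroupOf (centDerived G)) ≃*
      Multiplicative (ZMod (p ^ n) × ZMod (p ^ (m - 1)) × ZMod p))) :
    ∃ g ∈ centDerived G, g ^ p ^ (n - 1) ∉ phiG3 G := by
  obtain ⟨e⟩ := hC
  have hp : p.Prime := Fact.out
  obtain ⟨g, hg⟩ := QuotientGroup.mk'_surjective ((phiG3 G).subgroupOf (centDerived G))
    (e.symm (Multiplicative.ofAdd (1, 0, 0)))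
  refine ⟨g, g.2, fun h => ?_⟩
  have h1 : QuotientGroup.mk' ((phiG3 G).subgroupOf (centDerived G)) (g ^ p ^ (n - 1)) = 1 :=
    (QuotientGroup.eq_one_iff _).2 (Subgroup.mem_subgroupOf.2 h)
  rw [map_pow, hg, ← map_pow, e.symm.map_eq_one_iff, ← ofAdd_nsmul, ofAdd_eq_one] at h1
  have h2 := congrArg Prod.fst h1
  rw [Prod.smul_fst, nsmul_eq_mul, mul_one, Prod.fst_zero] at h2
  rw [ZMod.natCast_eq_zero_iff, Nat.pow_dvd_pow_iff_le_right hp.one_lt] at h2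
  omega

theorem isMExtension [Fact p.Prime] (hp : Odd p) (hm : 2 ≤ m) (hmn : m ≤ n)
    [Finite G] (hG : IsPGroup p G)
    (hG3 : Nonempty (G3 G ≃* Multiplicative (ZMod p)))
    (hK : Nonempty (phiG3 G ≃* Multiplicative (ZMod p × ZMod p)))
    (hM : Nonempty ((G ⧸ phiG3 G) ≃* MGroup p n m))
    (hC : Nonempty ((centDerived G ⧸ (phiG3 G).subgroupOf (centDerived G)) ≃*
      Multiplicative (ZMod (p ^ n) × ZMod (p ^ (m - 1)) × ZMod p))) :
    IsMExtension p n m G := by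
  have hpp : p.Prime := Fact.out
  have hnil := hG.isNilpotent
  obtain ⟨e3⟩ := hG3
  obtain ⟨eK⟩ := hK
  obtain ⟨eM⟩ := hM
  obtain ⟨a, b, hab, ha, hb, hcp⟩ := exists_generators_of_mulEquiv_MGroup hnil eM
  have card_G3 : Nat.card (G3 G) = p := by
    rw [Nat.card_congr e3.toEquiv, Nat.card_congr Multiplicative.toAdd, Nat.card_zmod]
  have card_phiG3 : Nat.card (phiG3 G) = p ^ 2 := by
    rw [Nat.card_congr eK.toEquiv, Nat.card_congr Multiplicative.toAdd, Nat.card_prod,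
      Nat.card_zmod, sq]
  have hcen : G3 G ≤ Subgroup.center G := hG.le_center_of_card_eq card_G3
  have hpow : ∀ k ∈ phiG3 G, k ^ p = 1 := by
    intro k hk
    have : (⟨k, hk⟩ : phiG3 G) ^ p = 1 := by
      apply eK.injective
      rw [map_pow, map_one]
      apply Multiplicative.toAdd.injective
      rw [toAdd_pow, toAdd_one]
      ext <;> simp
    simpa using congrArg Subtype.val this
  have hnot : ¬ commutator G ≤ phiG3 G :=
    not_commutator_le_phiG3 (by rw [card_G3, card_phiG3]; nlinarith [hpp.one_lt])
  have hle3 : G3 G ≤ phiG3 G := le_sup_right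
  have hcomm : ∀ d ∈ commutator G, d ^ p ∈ phiG3 G := by
    intro d hd
    obtain ⟨i, y, hy, rfl⟩ := exists_eq_zpow_mul_of_mem_commutator hab hd
    have : Commute (⁅a, b⁆ ^ i) y := Subgroup.mem_center_iff.1 (hcen hy) _
    rw [this.mul_pow, ← zpow_natCast, zpow_comm, zpow_natCast, hpow y (hle3 hy), mul_one]
    exact zpow_mem hcp i
  have hcenK : phiG3 G ≤ Subgroup.center G := by
    intro k hk
    obtain ⟨i, y, hy, rfl⟩ := exists_eq_zpow_mul_of_mem_commutator hab (phiG3_le_commutator hk)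
    refine mul_mem ?_ (hcen hy)
    -- If `p ∣ i`, centrality follows from that of `c ^ p`, which holds because `[g, c] ^ p = 1`.
    -- Otherwise `c ∈ K`, forcing `G' ≤ K`.
    by_cases hi : (p : ℤ) ∣ i
    · obtain ⟨i, rfl⟩ := hi
      rw [zpow_mul, zpow_natCast]
      refine zpow_mem ?_ i
      rw [Subgroup.mem_center_iff]
      intro g
      have hgd : ⁅g, ⁅a, b⁆⁆ ∈ G3 G :=
        commutatorElement_mem_G3 (commutatorElement_mem_commutator a b) g
      have h1 : SemiconjBy g ⁅a, b⁆ (⁅g, ⁅a, b⁆⁆ * ⁅a, b⁆) := by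
        rw [SemiconjBy, commutatorElement_def g]; group
      have h2 := h1.pow_right p
      have h3 : Commute ⁅g, ⁅a, b⁆⁆ ⁅a, b⁆ := (Subgroup.mem_center_iff.1 (hcen hgd) _).symm
      rw [h3.mul_pow, hpow _ (hle3 hgd), one_mul] at h2
      exact h2
    · exfalso
      refine hnot (commutator_le_of_closure_pair hab (hG.mem_of_zpow_mem hi ?_))
      have := mul_mem hk (inv_mem (hle3 hy))
      rwa [mul_inv_cancel_right] at this
  have hindex := index_centDerived_eq card_G3 hcen hab
  have hcomC : commutator G ≤ centDerived G := by
    refine commutator_le_of_index_prime hpp hindex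
  have hcard := card_eq_of_centDerived (n := n) hm card_phiG3
    (phiG3_le_commutator.trans hcomC) hindex hC
  have hmul : ∀ (g h : G) (k : ℕ),
      ((g ^ p ^ k * h ^ p ^ k)⁻¹ * (g * h) ^ p ^ k) ∈ phiG3 G := by
    intro g h k
    rw [← QuotientGroup.eq]
    simp only [QuotientGroup.mk_mul, QuotientGroup.mk_pow]
    symm
    refine mul_pow_prime_pow_of_commutator hpp hp ?_ ?_ _ _ k
    · intro x y
      obtain ⟨x, rfl⟩ := QuotientGroup.mk'_surjective _ x
      obtain ⟨y, rfl⟩ := QuotientGroup.mk'_surjective _ y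
      rw [Subgroup.mem_center_iff]
      intro g
      obtain ⟨g, rfl⟩ := QuotientGroup.mk'_surjective _ g
      rw [← commutatorElement_eq_one_iff_mul_comm, ← map_commutatorElement,
        ← map_commutatorElement]
      exact (QuotientGroup.eq_one_iff _).2
        (hle3 (commutatorElement_mem_G3 (commutatorElement_mem_commutator x y) g))
    · intro x y
      obtain ⟨x, rfl⟩ := QuotientGroup.mk'_surjective _ x
      obtain ⟨y, rfl⟩ := QuotientGroup.mk'_surjective _ y
      rw [← map_commutatorElement, ← map_pow]
      exact (QuotientGroup.eq_one_iff _).2 (hcomm _ (commutatorElement_mem_commutator x y))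
  have hmul' : ∀ (g h : G) (k : ℕ), g ^ p ^ k ∈ phiG3 G → h ^ p ^ k ∈ phiG3 G →
      (g * h) ^ p ^ k ∈ phiG3 G := by
    intro g h k hg hh
    have := mul_mem (mul_mem hg hh) (hmul g h k)
    rwa [mul_inv_cancel_left] at this
  have hle_pow : ∀ (g : G) {k l : ℕ}, k ≤ l → g ^ p ^ k ∈ phiG3 G → g ^ p ^ l ∈ phiG3 G := by
    intro g k l hkl hg
    obtain ⟨r, rfl⟩ := Nat.exists_eq_add_of_le hkl
    rw [pow_add, pow_mul]
    exact pow_mem hg _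
  have hzpow : ∀ (g : G) (i : ℤ) (k : ℕ), g ^ p ^ k ∈ phiG3 G → (g ^ i) ^ p ^ k ∈ phiG3 G := by
    intro g i k hg
    rw [← zpow_natCast, zpow_comm, zpow_natCast]
    exact zpow_mem hg i
  have hd_pow : ∀ d ∈ commutator G, ∀ k, 1 ≤ k → d ^ p ^ k ∈ phiG3 G := by
    intro d hd k hk
    exact hle_pow d hk (by rw [pow_one]; exact hcomm d hd)
  refine ⟨hG, card_G3, card_phiG3, hcen, hcenK, hpow, hnot, hcomm, hindex, hcard, hmul, ?_, ?_⟩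
  · intro g
    obtain ⟨i, j, d, hd, rfl⟩ := exists_eq_zpow_mul_zpow_mul_commutator hab g
    exact hmul' _ _ _ (hmul' _ _ _ (hzpow _ _ _ ha) (hzpow _ _ _ (hle_pow b hmn hb)))
      (hd_pow d hd n (by omega))
  -- The presentation does not say which generator fails to centralize `G'`. If `b` centralizes it
  -- and `m < n`, every element of `C_G(G')` has the form `a ^ (p i) b ^ j d`, so its `p ^ (n -
  -- 1)`-th power lies in `K`, contradicting the factor of order `p ^ n` in the type.
  · by_cases hbC : b ∈ centDerived G
    · have haC : a ∉ centDerived G := by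
        intro haC
        have : (centDerived G) = ⊤ := by
          rw [eq_top_iff, ← hab, Subgroup.closure_le]
          rintro g (rfl | rfl)
          · exact haC
          · exact hbC
        rw [this, Subgroup.index_top] at hindex
        exact hpp.one_lt.ne hindex
      rcases hmn.eq_or_lt with rfl | hlt
      · exact ⟨a, haC, ha⟩
      · exfalso
        obtain ⟨g, hgC, hg⟩ := exists_pow_notMem_phiG3 (by omega) hC
        obtain ⟨i, j, d, hd, rfl⟩ := exists_eq_zpow_mul_zpow_mul_commutator hab g
        have haiC : a ^ i ∈ centDerived G := by
          have := mul_mem (mul_mem hgC (inv_mem (hcomC hd))) (inv_mem (zpow_mem hbC j))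
          rwa [mul_inv_cancel_right, mul_inv_cancel_right] at this
        have hi : (p : ℤ) ∣ i := by
          by_contra hi
          exact haC (hG.mem_of_zpow_mem hi haiC)
        obtain ⟨i, rfl⟩ := hi
        refine hg (hmul' _ _ _ (hmul' _ _ _ ?_ (hzpow _ _ _ (hle_pow b (by omega) hb)))
          (hd_pow d hd _ (by omega)))
        rw [zpow_mul, zpow_natCast]
        refine hzpow _ _ _ ?_
        rw [← pow_mul, ← pow_succ', Nat.sub_add_cancel (by omega)]
        exact ha
    · exact ⟨b, hbC, hb⟩

end Structure

/-! ### Bounds on the indices of `𝒜₁`-subgroups. -/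

section Indices

variable {p n m : ℕ} {G : Type*} [Group G]

theorem IsMinimalNonabelian.exists_closure_pair_eq_top {H : Type*} [Group H]
    (h : IsMinimalNonabelian H) : ∃ x y : H, Subgroup.closure {x, y} = ⊤ := by
  obtain ⟨x, y, hxy⟩ := h.1
  refine ⟨x, y, ?_⟩
  by_contra hne
  exact hxy (h.2 _ hne x (Subgroup.subset_closure (by simp)) y (Subgroup.subset_closure (by simp)))

theorem card_le_sq_of_pow_eq_one {A : Type*} [CommGroup A] (hp : 0 < p)
    (hA : ∀ x : A, x ^ p = 1) {x y : A} (h : Subgroup.closure {x, y} = ⊤) :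
    Nat.card A ≤ p * p := by
  have := card_closure_pair_le (u := x) (v := y) (z := 1) (by rw [one_mul, mul_comm])
    (Commute.one_left _) (Commute.one_left _) hp hp one_pos (by rw [hA]; exact one_mem _)
    (by rw [hA]; exact one_mem _) (by simp)
  rw [h, Subgroup.card_top] at this
  simpa using this

/-- Because `m - 1 ≥ 1`, the group maps onto `C_p³`, which two elements cannot generate. -/
theorem not_isMinimalNonabelian_centDerived [Fact p.Prime] (hm : 2 ≤ m) (hn : 1 ≤ n)
    (hC : Nonempty ((centDerived G ⧸ (phiG3 G).subgroupOf (centDerived G)) ≃*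
      Multiplicative (ZMod (p ^ n) × ZMod (p ^ (m - 1)) × ZMod p))) :
    ¬ IsMinimalNonabelian (centDerived G) := by
  intro h
  have hp : p.Prime := Fact.out
  obtain ⟨x, y, hxy⟩ := IsMinimalNonabelian.exists_closure_pair_eq_top h
  obtain ⟨e⟩ := hC
  let ψ : ZMod (p ^ n) × ZMod (p ^ (m - 1)) × ZMod p →+ ZMod p × ZMod p × ZMod p :=
    (ZMod.castHom (dvd_pow_self p (by omega)) (ZMod p)).toAddMonoidHom.prodMap
      ((ZMod.castHom (dvd_pow_self p (by omega)) (ZMod p)).toAddMonoidHom.prodMap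
        (AddMonoidHom.id (ZMod p)))
  have hψ : Function.Surjective ψ :=
    (ZMod.castHom_surjective (dvd_pow_self p (by omega))).prodMap
      ((ZMod.castHom_surjective (dvd_pow_self p (by omega))).prodMap Function.surjective_id)
  let f : centDerived G →* Multiplicative (ZMod p × ZMod p × ZMod p) :=
    (AddMonoidHom.toMultiplicative ψ).comp (e.toMonoidHom.comp (QuotientGroup.mk' _))
  have hf : Function.Surjective f := by
    intro z
    obtain ⟨y, hy⟩ := hψ z.toAdd
    obtain ⟨g, hg⟩ := (e.surjective.comp (QuotientGroup.mk'_surjective _)) (Multiplicative.ofAdd y)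
    exact ⟨g, (congrArg (AddMonoidHom.toMultiplicative ψ) hg).trans hy⟩
  have h1 : Subgroup.closure {f x, f y} = ⊤ := by
    rw [← Set.image_pair, ← MonoidHom.map_closure, hxy, Subgroup.map_top_of_surjective _ hf]
  have h2 := card_le_sq_of_pow_eq_one hp.pos (fun z => by
    apply Multiplicative.toAdd.injective
    rw [toAdd_pow, toAdd_one]
    ext <;> simp) h1
  rw [Nat.card_congr Multiplicative.toAdd, Nat.card_prod, Nat.card_prod, Nat.card_zmod] at h2
  have := hp.one_lt
  have : 0 < p * p := by positivity
  nlinarith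

namespace IsMExtension

variable (hS : IsMExtension p n m G)

include hS

theorem finite [Fact p.Prime] : Finite G :=
  Nat.finite_of_card_ne_zero (by
    rw [hS.card_eq]
    exact pow_ne_zero _ (Fact.out : p.Prime).ne_zero)

/-- Modulo `K` the generators commute and have orders dividing `p ^ k` and `p`; `K` contributes at
most `p ^ 2`. -/
theorem card_closure_pair_mem_commutator_le [Fact p.Prime] {h d : G} (hd : d ∈ commutator G)
    {k : ℕ} (hh : h ^ p ^ k ∈ phiG3 G) : Nat.card (Subgroup.closure {h, d}) ≤ p ^ (k + 3) := by
  have := hS.finite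
  have hp : p.Prime := Fact.out
  refine (card_le_card_map_mk_mul _ (phiG3 G)).trans ?_
  rw [hS.card_phiG3, MonoidHom.map_closure, Set.image_pair]
  have hcomm : QuotientGroup.mk' (phiG3 G) h * QuotientGroup.mk' (phiG3 G) d =
      QuotientGroup.mk' (phiG3 G) d * QuotientGroup.mk' (phiG3 G) h := by
    rw [← commutatorElement_eq_one_iff_mul_comm, ← map_commutatorElement]
    exact (QuotientGroup.eq_one_iff _).2
      ((le_sup_right : G3 G ≤ phiG3 G) (commutatorElement_mem_G3 hd h))
  have h1 : QuotientGroup.mk' (phiG3 G) h ^ p ^ k = 1 := by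
    rw [← map_pow]; exact (QuotientGroup.eq_one_iff _).2 hh
  have h2 : QuotientGroup.mk' (phiG3 G) d ^ p = 1 := by
    rw [← map_pow]; exact (QuotientGroup.eq_one_iff _).2 (hS.pow_mem_of_mem_commutator d hd)
  have := card_closure_pair_le (u := QuotientGroup.mk' (phiG3 G) h)
    (v := QuotientGroup.mk' (phiG3 G) d) (z := 1) (by rw [one_mul, hcomm])
    (Commute.one_left _) (Commute.one_left _) (pow_pos hp.pos k) hp.pos one_pos
    (by rw [h1]; exact one_mem _) (by rw [h2]; exact one_mem _) (by simp)
  calc _ ≤ p ^ k * p * 1 * p ^ 2 := Nat.mul_le_mul_right _ this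
    _ = p ^ (k + 3) := by ring

theorem not_isMinimalNonabelian_of_commutator_le [Fact p.Prime] (hm : 2 ≤ m)
    (hC : ¬ IsMinimalNonabelian (centDerived G)) {H : Subgroup G}
    (hH : commutator G ≤ H) (hindex : H.index ≤ p) : ¬ IsMinimalNonabelian H := by
  intro hmin
  have := hS.finite
  have hp : p.Prime := Fact.out
  have hcard := H.card_mul_index
  by_cases hle : H ≤ centDerived G
  · have heq : H = centDerived G := by
      refine Subgroup.eq_of_le_of_card_ge hle ?_
      have h2 := (centDerived G).card_mul_index
      rw [hS.index_centDerived, ← hcard] at h2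
      by_contra! hlt
      have := Nat.mul_lt_mul_of_lt_of_le hlt hindex hp.pos
      omega
    exact hC (heq ▸ hmin)
  · obtain ⟨h, hh, hhC⟩ := SetLike.not_le_iff_exists.1 hle
    rw [Subgroup.mem_centralizer_iff] at hhC
    push Not at hhC
    obtain ⟨d, hd, hne⟩ := hhC
    have heq := hmin.eq_closure_pair hh (hH hd) hne.symm
    have h1 := hS.card_closure_pair_mem_commutator_le hd (hS.pow_mem h)
    rw [← heq] at h1
    have h2 := Nat.mul_le_mul h1 hindex
    rw [hcard, hS.card_eq, ← pow_succ, Nat.pow_le_pow_iff_right hp.one_lt] at h2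
    omega

theorem two_le_of_mem_a1IndexExponents [Fact p.Prime] (hm : 2 ≤ m)
    (hC : ¬ IsMinimalNonabelian (centDerived G)) {k : ℕ} (hk : k ∈ a1IndexExponents p G) :
    2 ≤ k := by
  have := hS.finite
  have := hS.isPGroup.isNilpotent
  have hp : p.Prime := Fact.out
  obtain ⟨H, hH, hind⟩ := hk
  by_contra! hlt
  obtain rfl | rfl : k = 0 ∨ k = 1 := by omega
  · rw [pow_zero, Subgroup.index_eq_one] at hind
    exact hS.not_isMinimalNonabelian_of_commutator_le hm hC (hind ▸ le_top)
      (by rw [hind, Subgroup.index_top]; exact hp.one_lt.le) hH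
  · rw [pow_one] at hind
    exact hS.not_isMinimalNonabelian_of_commutator_le hm hC (commutator_le_of_index_prime hp hind)
      hind.le hH

theorem exists_mem_a1IndexExponents [Fact p.Prime] : ∃ k ∈ a1IndexExponents p G, n ≤ k := by
  have := hS.finite
  have hp : p.Prime := Fact.out
  obtain ⟨b, hb, hbm⟩ := hS.exists_notMem
  rw [Subgroup.mem_centralizer_iff] at hb
  push Not at hb
  obtain ⟨d, hd, hne⟩ := hb
  have hz := commutatorElement_mem_G3 hd b
  have hcen := Subgroup.mem_center_iff.1 (hS.G3_le_center hz)
  obtain ⟨k, hk⟩ := hS.isPGroup.index (Subgroup.closure {b, d})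
  refine ⟨k, ⟨_, isMinimalNonabelian_closure_pair hS.isPGroup (hcen b).symm (hcen d).symm
    (fun h => hne (commutatorElement_eq_one_iff_mul_comm.1 h).symm)
    (hS.pow_eq_one _ ((le_sup_right : G3 G ≤ phiG3 G) hz)), hk⟩, ?_⟩
  have h1 := hS.card_closure_pair_mem_commutator_le hd hbm
  have h2 := (Subgroup.closure {b, d}).card_mul_index
  have h3 := Nat.mul_le_mul_right (p ^ k) h1
  rw [← hk, h2, hS.card_eq, hk, ← pow_add, Nat.pow_le_pow_iff_right hp.one_lt] at h3
  omega

/-- `sSup` of an unbounded set of naturals is `0`, so boundedness is needed before membership bounds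
`iMax` from below. -/
theorem bddAbove_a1IndexExponents [Fact p.Prime] : BddAbove (a1IndexExponents p G) := by
  refine ⟨n + m + 3, ?_⟩
  rintro k ⟨H, -, hk⟩
  have := H.index_dvd_card
  rw [hk, hS.card_eq] at this
  exact (Nat.pow_dvd_pow_iff_le_right (Fact.out : p.Prime).one_lt).1 this

theorem le_iMax [Fact p.Prime] {k : ℕ} (hk : k ∈ a1IndexExponents p G) : k ≤ iMax p G :=
  le_csSup hS.bddAbove_a1IndexExponents hk

end IsMExtension

end Indices

/-! ### Commutators and `p`-th powers in the coordinates `c ^ p`, `x` of `K`. -/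

theorem SemiconjBy.zpow_left_of_central {G : Type*} [Group G] {g v z : G}
    (h : SemiconjBy g v (z * v)) (hz : z ∈ Subgroup.center G) (i : ℤ) :
    SemiconjBy (g ^ i) v (z ^ i * v) := by
  rw [Subgroup.mem_center_iff] at hz
  have := zpow_mul_zpow_of_commutator_central (u := g) (v := v) (z := z)
    (by rw [h.eq, mul_assoc]) (hz g).symm (hz v).symm i 1
  rw [zpow_one, mul_one] at this
  rw [SemiconjBy, this, mul_assoc]

theorem SemiconjBy.mul_left_of_central {G : Type*} [Group G] {g h v y z : G}
    (hg : SemiconjBy g v (y * v)) (hh : SemiconjBy h v (z * v)) (hz : z ∈ Subgroup.center G) :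
    SemiconjBy (g * h) v (y * z * v) := by
  rw [Subgroup.mem_center_iff] at hz
  have h1 : SemiconjBy g (z * v) (z * (y * v)) := SemiconjBy.mul_right (hz g) hg
  rw [← mul_assoc, ← hz y] at h1
  exact h1.mul_left hh

/-- Generators `a`, `b` with `[a, [a, b]] = 1` and `[b, [a, b]] ≠ 1`. -/
structure IsCharPair {G : Type*} [Group G] (a b : G) : Prop where
  closure_eq : Subgroup.closure {a, b} = ⊤
  commute : Commute a ⁅a, b⁆
  ne_one : ⁅b, ⁅a, b⁆⁆ ≠ 1

/-- The element `c ^ (p i) x ^ j`, where `c = [a, b]` and `x = [b, c]`. -/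
def cxPow {G : Type*} [Group G] (p : ℕ) (a b : G) (i j : ℤ) : G :=
  (⁅a, b⁆ ^ p) ^ i * ⁅b, ⁅a, b⁆⁆ ^ j

theorem x_mem_G3 {G : Type*} [Group G] (a b : G) : ⁅b, ⁅a, b⁆⁆ ∈ G3 G :=
  commutatorElement_mem_G3 (commutatorElement_mem_commutator a b) b

theorem IsCharPair.semiconjBy_b_a_pow {G : Type*} [Group G] {a b : G} (hab : IsCharPair a b)
    (k : ℕ) : SemiconjBy b (a ^ k) ((⁅a, b⁆ ^ k)⁻¹ * a ^ k) := by
  have h1 : SemiconjBy b a (⁅a, b⁆⁻¹ * a) := by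
    rw [SemiconjBy, commutatorElement_def]; group
  have h2 := h1.pow_right k
  rwa [(hab.commute.symm.inv_left).mul_pow, inv_pow] at h2

theorem zpow_pow_comm {G : Type*} [Group G] (g : G) (i : ℤ) (k : ℕ) :
    (g ^ i) ^ k = (g ^ k) ^ i := by
  rw [← zpow_natCast, zpow_comm, zpow_natCast]

namespace IsMExtension

variable {p n m : ℕ} {G : Type*} [Group G] {a b : G}

section Basic

variable (hS : IsMExtension p n m G)

include hS

theorem G3_pow_eq_one {y : G} (hy : y ∈ G3 G) : y ^ p = 1 :=
  hS.pow_eq_one y ((le_sup_right : G3 G ≤ phiG3 G) hy)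

theorem q_mem (a b : G) : ⁅a, b⁆ ^ p ∈ phiG3 G :=
  hS.pow_mem_of_mem_commutator _ (commutatorElement_mem_commutator a b)

theorem q_pow (a b : G) : (⁅a, b⁆ ^ p) ^ p = 1 := hS.pow_eq_one _ (hS.q_mem a b)

theorem q_comm (a b g : G) : Commute (⁅a, b⁆ ^ p) g :=
  (Subgroup.mem_center_iff.1 (hS.phiG3_le_center (hS.q_mem a b)) g).symm

theorem x_pow (a b : G) : ⁅b, ⁅a, b⁆⁆ ^ p = 1 := hS.G3_pow_eq_one (x_mem_G3 a b)

theorem x_comm (a b g : G) : Commute ⁅b, ⁅a, b⁆⁆ g :=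
  (Subgroup.mem_center_iff.1 (hS.G3_le_center (x_mem_G3 a b)) g).symm

theorem cxPow_mem (i j : ℤ) : cxPow p a b i j ∈ phiG3 G :=
  mul_mem (zpow_mem (hS.q_mem a b) i)
    (zpow_mem ((le_sup_right : G3 G ≤ phiG3 G) (x_mem_G3 a b)) j)

theorem cxPow_mem_center (i j : ℤ) : cxPow p a b i j ∈ Subgroup.center G :=
  hS.phiG3_le_center (hS.cxPow_mem i j)

theorem cxPow_mul (i j k l : ℤ) :
    cxPow p a b i j * cxPow p a b k l = cxPow p a b (i + k) (j + l) := by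
  unfold cxPow
  rw [zpow_add, zpow_add, mul_assoc, mul_assoc]
  congr 1
  rw [← mul_assoc, ← mul_assoc]
  congr 1
  exact ((hS.x_comm a b _).zpow_left j).eq

theorem cxPow_zpow (i j k : ℤ) : cxPow p a b i j ^ k = cxPow p a b (i * k) (j * k) := by
  unfold cxPow
  rw [((hS.q_comm a b _).zpow_left i).mul_zpow, ← zpow_mul, ← zpow_mul]

theorem cxPow_congr {i j k l : ℤ} (h1 : (i : ZMod p) = k) (h2 : (j : ZMod p) = l) :
    cxPow p a b i j = cxPow p a b k l := by
  rw [ZMod.intCast_eq_intCast_iff] at h1 h2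
  unfold cxPow
  rw [zpow_eq_zpow_emod' i (hS.q_pow a b), zpow_eq_zpow_emod' k (hS.q_pow a b),
    zpow_eq_zpow_emod' j (hS.x_pow a b), zpow_eq_zpow_emod' l (hS.x_pow a b), h1, h2]

theorem commute_b_pow_c : Commute (b ^ p) ⁅a, b⁆ := by
  have h := zpow_mul_zpow_of_commutator_central (u := b) (v := ⁅a, b⁆) (z := ⁅b, ⁅a, b⁆⁆)
    (by rw [commutatorElement_def b]; group) (hS.x_comm a b _) (hS.x_comm a b _) p 1
  rwa [zpow_one, zpow_natCast, mul_one, zpow_natCast, hS.x_pow, one_mul] at h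

theorem exists_pow_eq (i j : ℤ) {d : G} (hd : d ∈ commutator G) :
    ∃ k ∈ phiG3 G, (a ^ i * b ^ j * d) ^ p = (a ^ p) ^ i * (b ^ p) ^ j * k := by
  have key : ∀ g h : G, ∃ k ∈ phiG3 G, (g * h) ^ p = g ^ p * h ^ p * k := fun g h => by
    have := hS.mul_pow_mem g h 1
    rw [pow_one] at this
    exact ⟨_, this, by group⟩
  obtain ⟨k, hk, h1⟩ := key (a ^ i * b ^ j) d
  obtain ⟨l, hl, h2⟩ := key (a ^ i) (b ^ j)
  have hd' := hS.pow_mem_of_mem_commutator d hd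
  refine ⟨l * d ^ p * k, mul_mem (mul_mem hl hd') hk, ?_⟩
  rw [h1, h2, zpow_pow_comm, zpow_pow_comm]
  simp only [mul_assoc]

variable [Fact p.Prime] (hodd : Odd p)

include hodd

/-- Conjugation by `a` takes `b` to `c b`, and in `(c b) ^ p` the correction `x ^ p.choose 2`
vanishes for odd `p`. -/
theorem semiconjBy_a_b_pow : SemiconjBy a (b ^ p) (⁅a, b⁆ ^ p * b ^ p) := by
  have hp : p.Prime := Fact.out
  have h1 : SemiconjBy a b (⁅a, b⁆ * b) := by
    rw [SemiconjBy, commutatorElement_def]; group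
  have h2 := h1.pow_right p
  rw [mul_pow_of_commutator_central (u := b) (v := ⁅a, b⁆) (z := ⁅b, ⁅a, b⁆⁆)
    (by rw [commutatorElement_def b]; group) (hS.x_comm a b _) (hS.x_comm a b _)] at h2
  obtain ⟨e, he⟩ : p ∣ p.choose 2 := hp.dvd_choose_self two_ne_zero
      (lt_of_le_of_ne hp.two_le fun e => by rw [← e] at hodd; exact absurd hodd (by decide))
  rwa [he, pow_mul, hS.x_pow, one_pow, one_mul] at h2

theorem commute_a_pow_b_pow : Commute (a ^ p) (b ^ p) := by
  have h := (hS.semiconjBy_a_b_pow (a := a) (b := b) hodd).zpow_left_of_central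
    (hS.phiG3_le_center (hS.q_mem a b)) p
  rwa [zpow_natCast, zpow_natCast, hS.q_pow, one_mul] at h

end Basic

section CharPair

variable [Fact p.Prime] (hS : IsMExtension p n m G) (hab : IsCharPair a b)

include hS hab

theorem exists_eq_zpow_x {y : G} (hy : y ∈ G3 G) : ∃ j : ℤ, y = ⁅b, ⁅a, b⁆⁆ ^ j := by
  have hne : (⟨_, x_mem_G3 a b⟩ : G3 G) ≠ 1 := fun h => hab.ne_one (congrArg Subtype.val h)
  obtain ⟨j, hj⟩ := mem_zpowers_of_prime_card (p := p) hS.card_G3 hne (g' := ⟨y, hy⟩)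
  exact ⟨j, (congrArg Subtype.val hj).symm⟩

theorem exists_eq_of_mem_commutator {d : G} (hd : d ∈ commutator G) :
    ∃ i j : ℤ, d = ⁅a, b⁆ ^ i * ⁅b, ⁅a, b⁆⁆ ^ j := by
  obtain ⟨i, y, hy, rfl⟩ := exists_eq_zpow_mul_of_mem_commutator hab.closure_eq hd
  obtain ⟨j, rfl⟩ := hS.exists_eq_zpow_x hab hy
  exact ⟨i, j, rfl⟩

theorem exists_eq_cxPow {k : G} (hk : k ∈ phiG3 G) : ∃ i j : ℤ, k = cxPow p a b i j := by
  obtain ⟨i, j, rfl⟩ := hS.exists_eq_of_mem_commutator hab (phiG3_le_commutator hk)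
  by_cases hi : (p : ℤ) ∣ i
  · obtain ⟨i, rfl⟩ := hi
    exact ⟨i, j, by rw [cxPow, zpow_mul, zpow_natCast]⟩
  · exfalso
    refine hS.not_commutator_le (commutator_le_of_closure_pair hab.closure_eq
      (hS.isPGroup.mem_of_zpow_mem hi ?_))
    have := mul_mem hk (inv_mem (zpow_mem ((le_sup_right : G3 G ≤ phiG3 G) (x_mem_G3 a b)) j))
    rwa [mul_inv_cancel_right] at this

theorem dvd_of_cxPow_eq_one {i j : ℤ} (h : cxPow p a b i j = 1) : (p : ℤ) ∣ i := by
  have hp : p.Prime := Fact.out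
  by_contra hi
  have hq : ⁅a, b⁆ ^ p ∈ Subgroup.zpowers ⁅b, ⁅a, b⁆⁆ := by
    refine hS.isPGroup.mem_of_zpow_mem hi ?_
    rw [eq_inv_of_mul_eq_one_left h]
    exact inv_mem (zpow_mem (Subgroup.mem_zpowers _) j)
  have hle : phiG3 G ≤ Subgroup.zpowers ⁅b, ⁅a, b⁆⁆ := by
    intro k hk
    obtain ⟨i, j, rfl⟩ := hS.exists_eq_cxPow hab hk
    exact mul_mem (zpow_mem hq i) (zpow_mem (Subgroup.mem_zpowers _) j)
  have := hS.finite
  have h1 := Subgroup.card_le_of_le hle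
  rw [hS.card_phiG3, Nat.card_zpowers] at h1
  have h2 := Nat.le_of_dvd hp.pos (orderOf_dvd_of_pow_eq_one (hS.x_pow a b))
  nlinarith [hp.one_lt]

/-- Two independent elements of `Φ(G') G₃` generate it. -/
theorem phiG3_le_of_det_ne_zero {H : Subgroup G} {i j k l : ℤ} (h1 : cxPow p a b i j ∈ H)
    (h2 : cxPow p a b k l ∈ H) (hdet : ((i * l - j * k : ℤ) : ZMod p) ≠ 0) : phiG3 G ≤ H := by
  have hd : ¬ (p : ℤ) ∣ i * l - j * k := fun h =>
    hdet ((ZMod.intCast_zmod_eq_zero_iff_dvd _ _).2 h)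
  have hq : ⁅a, b⁆ ^ p ∈ H := by
    refine hS.isPGroup.mem_of_zpow_mem hd ?_
    have := mul_mem (zpow_mem h1 l) (zpow_mem h2 (-j))
    rw [hS.cxPow_zpow, hS.cxPow_zpow, hS.cxPow_mul] at this
    have e : j * l + l * -j = 0 := by ring
    rw [e, cxPow, zpow_zero, mul_one] at this
    convert this using 2
    ring
  have hx : ⁅b, ⁅a, b⁆⁆ ∈ H := by
    refine hS.isPGroup.mem_of_zpow_mem hd ?_
    have := mul_mem (zpow_mem h1 (-k)) (zpow_mem h2 i)
    rw [hS.cxPow_zpow, hS.cxPow_zpow, hS.cxPow_mul] at this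
    have e : i * -k + k * i = 0 := by ring
    rw [e, cxPow, zpow_zero, one_mul] at this
    convert this using 2
    ring
  intro y hy
  obtain ⟨i, j, rfl⟩ := hS.exists_eq_cxPow hab hy
  exact mul_mem (zpow_mem hq i) (zpow_mem hx j)

variable (hodd : Odd p)

include hodd

/-- Conjugation by `a` multiplies the word by `(c ^ p) ^ s`, by `b` it multiplies it by `(c ^ p) ^
(-r) x ^ t`, and `c` and `x` centralize it. The factors are central, so they accumulate additively.
-/
theorem semiconjBy_word (i j k l r s t e f : ℤ) :
    SemiconjBy (a ^ i * b ^ j * (⁅a, b⁆ ^ k * ⁅b, ⁅a, b⁆⁆ ^ l))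
      ((a ^ p) ^ r * (b ^ p) ^ s * ⁅a, b⁆ ^ t * cxPow p a b e f)
      (cxPow p a b (i * s - j * r) (j * t) *
        ((a ^ p) ^ r * (b ^ p) ^ s * ⁅a, b⁆ ^ t * cxPow p a b e f)) := by
  set c := ⁅a, b⁆ with hc
  set x := ⁅b, c⁆ with hx
  set v := (a ^ p) ^ r * (b ^ p) ^ s * c ^ t * cxPow p a b e f with hv
  have hk : ∀ g, Commute g (cxPow p a b e f) :=
    fun g => Subgroup.mem_center_iff.1 (hS.cxPow_mem_center e f) g
  have ha : SemiconjBy a v (cxPow p a b s 0 * v) := by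
    have h1 : SemiconjBy a ((b ^ p) ^ s) ((c ^ p) ^ s * (b ^ p) ^ s) := by
      have := (hS.semiconjBy_a_b_pow (a := a) (b := b) hodd).zpow_right s
      rwa [(hS.q_comm a b _).mul_zpow] at this
    have h2 : Commute a ((a ^ p) ^ r) := ((Commute.refl a).pow_right p).zpow_right r
    have h3 : Commute a (c ^ t) := hab.commute.zpow_right t
    have h4 := ((SemiconjBy.mul_right h2 h1).mul_right h3).mul_right (hk a)
    have h5 : (a ^ p) ^ r * ((c ^ p) ^ s * (b ^ p) ^ s) =
        (c ^ p) ^ s * ((a ^ p) ^ r * (b ^ p) ^ s) := by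
      rw [← mul_assoc, ← mul_assoc, ((hS.q_comm a b _).zpow_left s).eq]
    rw [h5] at h4
    have h6 : cxPow p a b s 0 = (c ^ p) ^ s := by rw [cxPow, zpow_zero, mul_one]
    rw [h6, hv]
    simpa only [mul_assoc] using h4
  have hb : SemiconjBy b v (cxPow p a b (-r) t * v) := by
    have h1 : SemiconjBy b ((a ^ p) ^ r) ((c ^ p) ^ (-r) * (a ^ p) ^ r) := by
      have := (hab.semiconjBy_b_a_pow p).zpow_right r
      rwa [((hS.q_comm a b _).inv_left).mul_zpow, inv_zpow, ← zpow_neg] at this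
    have h2 : Commute b ((b ^ p) ^ s) := ((Commute.refl b).pow_right p).zpow_right s
    have h3 : SemiconjBy b (c ^ t) (x ^ t * c ^ t) := by
      have : SemiconjBy b c (x * c) := by
        rw [SemiconjBy, hx, commutatorElement_def b]; group
      have := this.zpow_right t
      rwa [(hS.x_comm a b _).mul_zpow] at this
    have h4 := ((SemiconjBy.mul_right h1 h2).mul_right h3).mul_right (hk b)
    have h5 : (c ^ p) ^ (-r) * (a ^ p) ^ r * (b ^ p) ^ s * (x ^ t * c ^ t) =
        (c ^ p) ^ (-r) * x ^ t * ((a ^ p) ^ r * (b ^ p) ^ s * c ^ t) := by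
      have h6 : Commute (x ^ t) ((a ^ p) ^ r * (b ^ p) ^ s) := (hS.x_comm a b _).zpow_left t
      calc _ = (c ^ p) ^ (-r) * (((a ^ p) ^ r * (b ^ p) ^ s) * x ^ t) * c ^ t := by
            simp only [mul_assoc]
        _ = _ := by rw [← h6.eq]; simp only [mul_assoc]
    rw [h5] at h4
    have h6 : cxPow p a b (-r) t = (c ^ p) ^ (-r) * x ^ t := rfl
    rw [h6, hv]
    simpa only [mul_assoc] using h4
  have hcv : SemiconjBy c v (1 * v) := by
    rw [one_mul]
    have h1 : Commute c ((a ^ p) ^ r) := (hab.commute.symm.pow_right p).zpow_right r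
    have h2 : Commute c ((b ^ p) ^ s) := hS.commute_b_pow_c.symm.zpow_right s
    exact ((h1.mul_right h2).mul_right ((Commute.refl c).zpow_right t)).mul_right (hk c)
  have hxv : SemiconjBy x v (1 * v) := by
    rw [one_mul]
    exact hS.x_comm a b v
  have h := ((ha.zpow_left_of_central (hS.cxPow_mem_center _ _) i).mul_left_of_central
      (hb.zpow_left_of_central (hS.cxPow_mem_center _ _) j)
      (zpow_mem (hS.cxPow_mem_center _ _) j)).mul_left_of_central
    ((hcv.zpow_left_of_central (one_mem _) k).mul_left_of_central
      (hxv.zpow_left_of_central (one_mem _) l) (by simp)) (by simp)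
  simp only [one_zpow, mul_one] at h
  rw [hS.cxPow_zpow, hS.cxPow_zpow, hS.cxPow_mul] at h
  have e1 : s * i + -r * j = i * s - j * r := by ring
  have e2 : 0 * i + t * j = j * t := by ring
  rwa [e1, e2] at h

theorem word_pow (r s t e f : ℤ) :
    ((a ^ p) ^ r * (b ^ p) ^ s * ⁅a, b⁆ ^ t * cxPow p a b e f) ^ p =
      (a ^ p ^ 2) ^ r * (b ^ p ^ 2) ^ s * cxPow p a b t 0 := by
  have h1 : Commute ((a ^ p) ^ r) ((b ^ p) ^ s) :=
    (hS.commute_a_pow_b_pow hodd).zpow_zpow r s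
  have h2 : Commute ((a ^ p) ^ r) (⁅a, b⁆ ^ t) := (hab.commute.pow_left p).zpow_zpow r t
  have h3 : Commute ((b ^ p) ^ s) (⁅a, b⁆ ^ t) := hS.commute_b_pow_c.zpow_zpow s t
  have h4 : ∀ g, Commute g (cxPow p a b e f) :=
    fun g => Subgroup.mem_center_iff.1 (hS.cxPow_mem_center e f) g
  rw [(h4 _).mul_pow, (h2.mul_left h3).mul_pow, h1.mul_pow, hS.pow_eq_one _ (hS.cxPow_mem e f),
    zpow_pow_comm, zpow_pow_comm, zpow_pow_comm, ← pow_mul, ← pow_mul, ← sq, cxPow, zpow_zero,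
    mul_one, mul_one]

/-- Modulo `K` the `p`-th power is `a ^ (p i) b ^ (p j)`, which is a word covered by `word_pow` with
`t = 0`. -/
theorem word_pow_sq (i j : ℤ) {d : G} (hd : d ∈ commutator G) :
    (a ^ i * b ^ j * d) ^ p ^ 2 = (a ^ p ^ 2) ^ i * (b ^ p ^ 2) ^ j := by
  obtain ⟨k, hk, h⟩ := hS.exists_pow_eq (a := a) (b := b) i j hd
  obtain ⟨e, f, rfl⟩ := hS.exists_eq_cxPow hab hk
  have := hS.word_pow hab hodd i j 0 e f
  rw [zpow_zero, mul_one] at this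
  rw [sq p, pow_mul, h, this, ← sq]
  simp [cxPow]

end CharPair

end IsMExtension

/-! ### The quadratic over `𝔽_p`. -/

theorem false_of_det_eq_zero {F : Type*} [Field F] {w₁₁ w₁₂ w₂₁ w₂₂ i j r s t : F}
    (hw : (w₁₁ = 0 ∧ w₁₂ = 0 ∧ w₂₂ ≠ 0) ∨ ¬ IsSquare (w₁₁ ^ 2 - 4 * w₁₂))
    (hne : ¬ (i * s - j * r = 0 ∧ j * t = 0))
    (h1 : (i * s - j * r) * (r * w₁₂ + s * w₂₂) - j * t * (r * w₁₁ + s * w₂₁ + t) = 0)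
    (h2 : (i * s - j * r) * (i * w₁₂ + j * w₂₂) - j * t * (i * w₁₁ + j * w₂₁) = 0) : False := by
  -- Eliminating `w₂₁` and `w₂₂` leaves a quadratic form in `j t` and `D = i s - j r`; `D ≠ 0` since
  -- the vector `(D, j t)` is nonzero.
  have h3 : (j * t) ^ 2 - (j * t) * (i * s - j * r) * w₁₁ + (i * s - j * r) ^ 2 * w₁₂ = 0 := by
    linear_combination s * h2 - j * h1
  have hD : i * s - j * r ≠ 0 := by
    intro hD
    refine hne ⟨hD, ?_⟩
    rw [hD] at h3
    have : (j * t) ^ 2 = 0 := by linear_combination h3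
    exact pow_eq_zero_iff two_ne_zero |>.1 this
  rcases hw with ⟨rfl, rfl, hw⟩ | hw
  · have hy : j * t = 0 := pow_eq_zero_iff two_ne_zero |>.1 (by linear_combination h3)
    have hs : s = 0 := by
      have : (i * s - j * r) * w₂₂ * s = 0 := by
        linear_combination h1 + (s * w₂₁ + t) * hy
      exact (mul_eq_zero.1 this).resolve_left (mul_ne_zero hD hw)
    have hj : j = 0 := by
      have : (i * s - j * r) * w₂₂ * j = 0 := by
        linear_combination h2 + (j * w₂₁) * hy
      exact (mul_eq_zero.1 this).resolve_left (mul_ne_zero hD hw)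
    exact hD (by rw [hs, hj]; ring)
  · refine hw ⟨(2 * (j * t) - (i * s - j * r) * w₁₁) / (i * s - j * r), ?_⟩
    field_simp
    linear_combination (-4) * h3

/-- A nonzero root `l` lets the second equation be solved for `i`. If both roots vanish, then `w₁₁ =
w₁₂ = 0`, and the failure of (i) gives `w₂₂ = 0`. -/
theorem exists_root_of_isSquare {F : Type*} [Field F] (h2 : (2 : F) ≠ 0) {w₁₁ w₁₂ w₂₁ w₂₂ : F}
    (hw : ¬ (w₁₁ = 0 ∧ w₁₂ = 0 ∧ w₂₂ ≠ 0)) (hsq : IsSquare (w₁₁ ^ 2 - 4 * w₁₂)) :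
    ∃ l i : F, l ^ 2 + l * w₁₁ + w₁₂ = 0 ∧ w₂₂ + l * w₂₁ = i * l ^ 2 := by
  obtain ⟨δ, hδ⟩ := hsq
  have key : ∀ ε : F, ε * ε = δ * δ →
      ((-w₁₁ + ε) / 2) ^ 2 + (-w₁₁ + ε) / 2 * w₁₁ + w₁₂ = 0 := by
    intro ε hε
    field_simp
    linear_combination hε - hδ
  have key2 : ∀ l : F, l ≠ 0 → w₂₂ + l * w₂₁ = (w₂₂ + l * w₂₁) / l ^ 2 * l ^ 2 := by
    intro l hl
    field_simp
  by_cases h3 : (-w₁₁ + δ) / 2 = 0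
  · by_cases h4 : (-w₁₁ + -δ) / 2 = 0
    · have h5 : w₁₁ = 0 := by
        linear_combination -(h3 + h4) - w₁₁ * mul_inv_cancel₀ h2
      have h6 : w₁₂ = 0 := by
        have := key δ rfl
        rw [h3] at this
        linear_combination this
      refine ⟨0, 0, by rw [h6]; ring, ?_⟩
      have : w₂₂ = 0 := by
        by_contra h7
        exact hw ⟨h5, h6, h7⟩
      rw [this]
      ring
    · exact ⟨_, _, key (-δ) (by ring), key2 _ h4⟩
  · exact ⟨_, _, key δ rfl, key2 _ h3⟩

/-! ### Orders of non-abelian subgroups, chiefly for `n = m = 2`. -/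

namespace IsMExtension

variable {p : ℕ} {G : Type*} [Group G] {a b : G}

section

variable {n m : ℕ} [Fact p.Prime] (hS : IsMExtension p n m G) (hab : IsCharPair a b)

include hS hab

theorem exists_eq_word {g : G} {i j : ℤ}
    (h : Abelianization.of g = Abelianization.of a ^ i * Abelianization.of b ^ j) :
    ∃ k l : ℤ, g = a ^ i * b ^ j * (⁅a, b⁆ ^ k * ⁅b, ⁅a, b⁆⁆ ^ l) := by
  have hd : (a ^ i * b ^ j)⁻¹ * g ∈ commutator G := by
    rw [← Abelianization.ker_of, MonoidHom.mem_ker, map_mul, map_inv, h]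
    simp
  obtain ⟨k, l, hkl⟩ := hS.exists_eq_of_mem_commutator hab hd
  exact ⟨k, l, by rw [← hkl, mul_inv_cancel_left]⟩

theorem exists_eq_pow_word {g : G} {r s : ℤ}
    (h : Abelianization.of g = Abelianization.of a ^ (p * r) * Abelianization.of b ^ (p * s)) :
    ∃ t f : ℤ, g = (a ^ p) ^ r * (b ^ p) ^ s * ⁅a, b⁆ ^ t * cxPow p a b 0 f := by
  obtain ⟨t, f, rfl⟩ := hS.exists_eq_word hab h
  refine ⟨t, f, ?_⟩
  rw [cxPow, zpow_zero, one_mul, zpow_mul, zpow_mul, zpow_natCast, zpow_natCast]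
  simp only [mul_assoc]

omit hS [Fact p.Prime] in
theorem exists_abelianization_eq (g : G) :
    ∃ i j : ℤ, Abelianization.of g = Abelianization.of a ^ i * Abelianization.of b ^ j := by
  obtain ⟨i, j, d, hd, rfl⟩ := exists_eq_zpow_mul_zpow_mul_commutator hab.closure_eq g
  rw [← Abelianization.ker_of, MonoidHom.mem_ker] at hd
  exact ⟨i, j, by rw [map_mul, hd, mul_one, map_mul, map_zpow, map_zpow]⟩

theorem eq_top_of_det {H : Subgroup G} {g h : G} (hg : g ∈ H) (hh : h ∈ H) {i j r s : ℤ}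
    (eg : Abelianization.of g = Abelianization.of a ^ i * Abelianization.of b ^ j)
    (eh : Abelianization.of h = Abelianization.of a ^ r * Abelianization.of b ^ s)
    (hd : ¬ (p : ℤ) ∣ i * s - j * r) : H = ⊤ := by
  have := hS.finite
  have := hS.isPGroup.isNilpotent
  have key : ∀ x y : G, y ∈ H → Abelianization.of x = Abelianization.of y →
      x ∈ H ⊔ commutator G := by
    intro x y hy hxy
    have : y⁻¹ * x ∈ commutator G := by
      rw [← Abelianization.ker_of, MonoidHom.mem_ker, map_mul, map_inv, hxy, inv_mul_cancel]
    have h2 := Subgroup.mul_mem_sup hy this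
    rwa [mul_inv_cancel_left] at h2
  apply eq_top_of_sup_commutator_eq_top
  rw [eq_top_iff, ← hab.closure_eq, Subgroup.closure_le]
  rintro x (rfl | rfl)
  · refine hS.isPGroup.mem_of_zpow_mem hd (key _ (g ^ s * h ^ (-j))
      (mul_mem (zpow_mem hg _) (zpow_mem hh _)) ?_)
    rw [map_mul, map_zpow, map_zpow, map_zpow, eg, eh, mul_zpow, mul_zpow, ← zpow_mul, ← zpow_mul,
      ← zpow_mul, ← zpow_mul, mul_mul_mul_comm, ← zpow_add, ← zpow_add]
    have e1 : j * s + s * -j = 0 := by ring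
    have e2 : i * s + r * -j = i * s - j * r := by ring
    rw [e1, e2, zpow_zero, mul_one]
  · refine hS.isPGroup.mem_of_zpow_mem hd (key _ (g ^ (-r) * h ^ i)
      (mul_mem (zpow_mem hg _) (zpow_mem hh _)) ?_)
    rw [map_mul, map_zpow, map_zpow, map_zpow, eg, eh, mul_zpow, mul_zpow, ← zpow_mul, ← zpow_mul,
      ← zpow_mul, ← zpow_mul, mul_mul_mul_comm, ← zpow_add, ← zpow_add]
    have e1 : i * -r + r * i = 0 := by ring
    have e2 : j * -r + s * i = i * s - j * r := by ring
    rw [e1, e2, zpow_zero, one_mul]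

/-- Noncommuting elements of a proper subgroup can be chosen with one of them in `Φ(G)`. -/
theorem exists_noncommuting_normalized (hodd : Odd p) {H : Subgroup G} (hH : H ≠ ⊤) {g h : G}
    (hg : g ∈ H) (hh : h ∈ H) (hgh : ¬ Commute g h) :
    ∃ u ∈ H, ∃ v ∈ H, ¬ Commute u v ∧ ∃ i j r s : ℤ, (¬ (p : ℤ) ∣ i ∨ ¬ (p : ℤ) ∣ j) ∧
      Abelianization.of u = Abelianization.of a ^ i * Abelianization.of b ^ j ∧
      Abelianization.of v =
        Abelianization.of a ^ (p * r) * Abelianization.of b ^ (p * s) := by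
  have hp : Prime (p : ℤ) := Nat.prime_iff_prime_int.1 Fact.out
  obtain ⟨i, j, eg⟩ := exists_abelianization_eq hab g
  obtain ⟨r, s, eh⟩ := exists_abelianization_eq hab h
  have hdet : (p : ℤ) ∣ i * s - j * r := by
    by_contra hd
    exact hH (hS.eq_top_of_det hab hg hh eg eh hd)
  by_cases hij : (p : ℤ) ∣ i ∧ (p : ℤ) ∣ j
  · obtain ⟨⟨i, rfl⟩, ⟨j, rfl⟩⟩ := hij
    by_cases hrs : (p : ℤ) ∣ r ∧ (p : ℤ) ∣ s
    · exfalso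
      obtain ⟨⟨r, rfl⟩, ⟨s, rfl⟩⟩ := hrs
      obtain ⟨k, l, eg'⟩ := hS.exists_eq_word hab eg
      obtain ⟨t, f, eh'⟩ := hS.exists_eq_pow_word hab eh
      have h1 := hS.semiconjBy_word hab hodd (p * i) (p * j) k l r s t 0 f
      rw [← eg', ← eh'] at h1
      have h2 : cxPow p a b (p * i * s - p * j * r) (p * j * t) = cxPow p a b 0 0 :=
        hS.cxPow_congr (by simp) (by simp)
      rw [h2, cxPow, zpow_zero, zpow_zero, one_mul, one_mul] at h1
      exact hgh h1
    · exact ⟨h, hh, g, hg, fun h => hgh h.symm, r, s, i, j, not_and_or.1 hrs, eh, eg⟩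
  -- The exponent vectors of `g` and `h` are dependent modulo `p`, so dividing `h` by a suitable `g
  -- ^ l` makes its exponents multiples of `p`. Below, `l` is obtained by inverting `i` or `j`
  -- modulo `p`.
  · have key : ∀ l : ℤ, (p : ℤ) ∣ r - l * i → (p : ℤ) ∣ s - l * j →
        ∃ u ∈ H, ∃ v ∈ H, ¬ Commute u v ∧ ∃ i j r s : ℤ, (¬ (p : ℤ) ∣ i ∨ ¬ (p : ℤ) ∣ j) ∧
          Abelianization.of u = Abelianization.of a ^ i * Abelianization.of b ^ j ∧
          Abelianization.of v =
            Abelianization.of a ^ (p * r) * Abelianization.of b ^ (p * s) := by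
      rintro l ⟨r', hr'⟩ ⟨s', hs'⟩
      refine ⟨g, hg, h * g ^ (-l), mul_mem hh (zpow_mem hg _), ?_, i, j, r', s',
        not_and_or.1 hij, eg, ?_⟩
      · intro hc
        have := hc.mul_right ((Commute.refl g).zpow_right l)
        rw [mul_assoc, ← zpow_add, neg_add_cancel, zpow_zero, mul_one] at this
        exact hgh this
      · rw [← hr', ← hs', map_mul, map_zpow, eg, eh, mul_zpow, ← zpow_mul, ← zpow_mul,
          mul_mul_mul_comm, ← zpow_add, ← zpow_add]
        congr 2 <;> ring
    rcases not_and_or.1 hij with hi | hj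
    · obtain ⟨x, y, hxy⟩ := (hp.coprime_iff_not_dvd.2 hi).symm
      have h1 : (p : ℤ) ∣ r - r * x * i := ⟨r * y, by linear_combination -r * hxy⟩
      refine key (r * x) h1 ((hp.dvd_or_dvd (a := i) ?_).resolve_left hi)
      have e : i * (s - r * x * j) = (i * s - j * r) + j * (r - r * x * i) := by ring
      rw [e]
      exact dvd_add hdet (h1.mul_left j)
    · obtain ⟨x, y, hxy⟩ := (hp.coprime_iff_not_dvd.2 hj).symm
      have h1 : (p : ℤ) ∣ s - s * x * j := ⟨s * y, by linear_combination -s * hxy⟩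
      refine key (s * x) ((hp.dvd_or_dvd (a := j) ?_).resolve_left hj) h1
      have e : j * (r - s * x * i) = -(i * s - j * r) + i * (s - s * x * j) := by ring
      rw [e]
      exact dvd_add (hdet.neg_right) (h1.mul_left i)

theorem card_commutator_le : Nat.card (commutator G) ≤ p ^ 3 := by
  have := hS.finite
  have hle : commutator G ≤ Subgroup.closure {⁅b, ⁅a, b⁆⁆, ⁅a, b⁆} := by
    intro d hd
    obtain ⟨i, j, rfl⟩ := hS.exists_eq_of_mem_commutator hab hd
    exact mul_mem (zpow_mem (Subgroup.subset_closure (by simp)) i)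
      (zpow_mem (Subgroup.subset_closure (by simp)) j)
  refine (Subgroup.card_le_of_le hle).trans ?_
  refine hS.card_closure_pair_mem_commutator_le (commutatorElement_mem_commutator a b) (k := 0) ?_
  rw [pow_zero, pow_one]
  exact (le_sup_right : G3 G ≤ phiG3 G) (x_mem_G3 a b)

end

variable [Fact p.Prime] (hS : IsMExtension p 2 2 G) (hab : IsCharPair a b)

include hS hab

/-- Since `|G'| ≤ p ^ 3` and `|G| = p ^ 7`, the surjection from `(ℤ/p²)²` onto `G/G'` is injective
by counting. -/
theorem dvd_of_abelianization_eq_one {i j : ℤ}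
    (h : Abelianization.of a ^ i * Abelianization.of b ^ j = 1) :
    ((p ^ 2 : ℕ) : ℤ) ∣ i ∧ ((p ^ 2 : ℕ) : ℤ) ∣ j := by
  have hp : p.Prime := Fact.out
  have := hS.finite
  have : NeZero (p ^ 2) := ⟨pow_ne_zero _ hp.ne_zero⟩
  have hpow : ∀ g : G, Abelianization.of g ^ p ^ 2 = 1 := by
    intro g
    rw [← map_pow, ← MonoidHom.mem_ker, Abelianization.ker_of]
    exact phiG3_le_commutator (hS.pow_mem g)
  let f : ZMod (p ^ 2) × ZMod (p ^ 2) → Abelianization G :=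
    fun x => Abelianization.of a ^ x.1.val * Abelianization.of b ^ x.2.val
  have hf : ∀ i j : ℤ, f (i, j) = Abelianization.of a ^ i * Abelianization.of b ^ j := by
    intro i j
    change Abelianization.of a ^ (i : ZMod (p ^ 2)).val *
      Abelianization.of b ^ (j : ZMod (p ^ 2)).val = _
    rw [← zpow_natCast, ← zpow_natCast, ZMod.val_intCast, ZMod.val_intCast,
      ← zpow_eq_zpow_emod' i (hpow a), ← zpow_eq_zpow_emod' j (hpow b)]
  have hsurj : Function.Surjective f := by
    intro y
    obtain ⟨g, rfl⟩ := QuotientGroup.mk_surjective y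
    obtain ⟨i, j, hij⟩ := exists_abelianization_eq hab g
    exact ⟨(i, j), (hf i j).trans hij.symm⟩
  have hcard : Nat.card (ZMod (p ^ 2) × ZMod (p ^ 2)) ≤ Nat.card (Abelianization G) := by
    have h1 := (commutator G).card_mul_index
    rw [hS.card_eq] at h1
    have h2 : p ^ 3 * p ^ 4 ≤ p ^ 3 * (commutator G).index := by
      calc p ^ 3 * p ^ 4 = Nat.card (commutator G) * (commutator G).index := by rw [h1]; ring
        _ ≤ _ := Nat.mul_le_mul_right _ (hS.card_commutator_le hab)
    have h3 := Nat.le_of_mul_le_mul_left h2 (pow_pos hp.pos 3)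
    rw [Nat.card_prod, Nat.card_zmod, ← pow_add]
    exact h3
  have hbij := Function.Surjective.bijective_of_nat_card_le hsurj hcard
  have h0 := hbij.1 ((hf i j).trans (h.trans (by simpa using (hf 0 0).symm)))
  rw [Prod.mk.injEq] at h0
  exact ⟨(ZMod.intCast_zmod_eq_zero_iff_dvd _ _).1 h0.1,
    (ZMod.intCast_zmod_eq_zero_iff_dvd _ _).1 h0.2⟩

theorem pow_notMem_phiG3 {u : G} {i j : ℤ} (hij : ¬ (p : ℤ) ∣ i ∨ ¬ (p : ℤ) ∣ j)
    (hu : Abelianization.of u = Abelianization.of a ^ i * Abelianization.of b ^ j) :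
    u ^ p ∉ phiG3 G := by
  intro h
  have hp : (p : ℤ) ≠ 0 := Nat.cast_ne_zero.2 (Fact.out : p.Prime).ne_zero
  have h1 := phiG3_le_commutator h
  rw [← Abelianization.ker_of, MonoidHom.mem_ker, map_pow, hu, mul_pow, zpow_pow_comm,
    zpow_pow_comm, ← zpow_natCast, ← zpow_natCast, ← zpow_mul, ← zpow_mul] at h1
  obtain ⟨h2, h3⟩ := hS.dvd_of_abelianization_eq_one hab h1
  rw [sq, Nat.cast_mul] at h2 h3
  rcases hij with hi | hj
  · exact hi ((mul_dvd_mul_iff_left hp).1 h2)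
  · exact hj ((mul_dvd_mul_iff_left hp).1 h3)

omit hab in
-- The chain `K < K⟨u ^ p⟩ < K⟨u⟩ < H` is strict, the last step because every element of `K⟨u⟩`
-- commutes with `u`.
theorem pow_five_le_card {H : Subgroup G} (hK : phiG3 G ≤ H) {u v : G} (hu : u ∈ H) (hv : v ∈ H)
    (huv : ¬ Commute u v) (hup : u ^ p ∉ phiG3 G) : p ^ 5 ≤ Nat.card H := by
  have := hS.finite
  have hpp := hS.isPGroup
  have hp : Prime (p : ℤ) := Nat.prime_iff_prime_int.1 Fact.out
  have h1 : phiG3 G < phiG3 G ⊔ Subgroup.zpowers (u ^ p) :=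
    left_lt_sup.2 fun h => hup (h (Subgroup.mem_zpowers _))
  have h2 : phiG3 G ⊔ Subgroup.zpowers (u ^ p) < phiG3 G ⊔ Subgroup.zpowers u := by
    refine lt_of_le_of_ne (sup_le_sup_left ?_ _) fun h => ?_
    · rw [Subgroup.zpowers_le]
      exact Subgroup.pow_mem _ (Subgroup.mem_zpowers u) p
    · have hmem : u ∈ phiG3 G ⊔ Subgroup.zpowers (u ^ p) :=
        h.symm ▸ (le_sup_right : Subgroup.zpowers u ≤ _) (Subgroup.mem_zpowers u)
      obtain ⟨k, hk, _, ⟨e, rfl⟩, hu'⟩ := Subgroup.mem_sup_of_normal_left.1 hmem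
      have hnd : ¬ (p : ℤ) ∣ 1 - p * e := by
        intro hd
        have := dvd_add hd (dvd_mul_right (p : ℤ) e)
        rw [sub_add_cancel] at this
        exact hp.not_isUnit (isUnit_of_dvd_one this)
      have huK : u ∈ phiG3 G := by
        refine hpp.mem_of_zpow_mem hnd ?_
        have : u ^ (1 - p * e) = k := by
          rw [zpow_sub, zpow_one, zpow_mul, zpow_natCast]
          exact mul_inv_eq_of_eq_mul hu'.symm
        rwa [this]
      exact hup (Subgroup.pow_mem _ huK p)
  have h3 : phiG3 G ⊔ Subgroup.zpowers u < H := by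
    refine lt_of_le_of_ne (sup_le hK (by rwa [Subgroup.zpowers_le])) fun h => ?_
    rw [← h] at hv
    obtain ⟨k, hk, _, ⟨e, rfl⟩, rfl⟩ := Subgroup.mem_sup_of_normal_left.1 hv
    exact huv (Commute.mul_right (Subgroup.mem_center_iff.1 (hS.phiG3_le_center hk) u)
      ((Commute.refl u).zpow_right e))
  exact hpp.pow_succ_le_card h3 (hpp.pow_succ_le_card h2 (hpp.pow_succ_le_card h1
    hS.card_phiG3.ge))

variable (hodd : Odd p) {w₁₁ w₁₂ w₂₁ w₂₂ : ℤ} (ha : a ^ p ^ 2 = cxPow p a b w₁₁ w₁₂)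
  (hb : b ^ p ^ 2 = cxPow p a b w₂₁ w₂₂)

include hodd ha hb

theorem pow_five_le_card_of_ne_top
    (hw : ((w₁₁ : ZMod p) = 0 ∧ (w₁₂ : ZMod p) = 0 ∧ (w₂₂ : ZMod p) ≠ 0) ∨
      ¬ IsSquare ((w₁₁ : ZMod p) ^ 2 - 4 * w₁₂))
    {H : Subgroup G} (hH : H ≠ ⊤) {g h : G} (hg : g ∈ H) (hh : h ∈ H) (hgh : ¬ Commute g h) :
    p ^ 5 ≤ Nat.card H := by
  obtain ⟨u, hu, v, hv, huv, i, j, r, s, hij, eu, ev⟩ :=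
    hS.exists_noncommuting_normalized hab hodd hH hg hh hgh
  have hup := hS.pow_notMem_phiG3 hab hij eu
  obtain ⟨k, l, eu'⟩ := hS.exists_eq_word hab eu
  obtain ⟨t, f, ev'⟩ := hS.exists_eq_pow_word hab ev
  have hz := hS.semiconjBy_word hab hodd i j k l r s t 0 f
  rw [← eu', ← ev'] at hz
  have hzH : cxPow p a b (i * s - j * r) (j * t) ∈ H := by
    have : cxPow p a b (i * s - j * r) (j * t) = u * v * u⁻¹ * v⁻¹ := by
      rw [hz.eq]; group
    rw [this]
    exact mul_mem (mul_mem (mul_mem hu hv) (inv_mem hu)) (inv_mem hv)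
  have hvp : cxPow p a b (w₁₁ * r + w₂₁ * s + t) (w₁₂ * r + w₂₂ * s + 0) ∈ H := by
    have h1 := hS.word_pow hab hodd r s t 0 f
    rw [← ev', ha, hb, hS.cxPow_zpow, hS.cxPow_zpow, hS.cxPow_mul, hS.cxPow_mul] at h1
    rw [← h1]
    exact Subgroup.pow_mem _ hv p
  have hup2 : cxPow p a b (w₁₁ * i + w₂₁ * j) (w₁₂ * i + w₂₂ * j) ∈ H := by
    have h1 := hS.word_pow_sq hab hodd i j
      (mul_mem (zpow_mem (commutatorElement_mem_commutator a b) k)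
        (zpow_mem (commutatorElement_mem_commutator b ⁅a, b⁆) l))
    rw [← eu', ha, hb, hS.cxPow_zpow, hS.cxPow_zpow, hS.cxPow_mul] at h1
    rw [← h1]
    exact Subgroup.pow_mem _ hu _
  refine hS.pow_five_le_card ?_ hu hv huv hup
  -- If `K` is not contained in `H`, then `v ^ p` and `u ^ (p ^ 2)` are both dependent on `[u, v]`,
  -- so two determinants vanish.
  by_contra hK
  have d1 := not_not.1 fun hd => hK (hS.phiG3_le_of_det_ne_zero hab hzH hvp hd)
  have d2 := not_not.1 fun hd => hK (hS.phiG3_le_of_det_ne_zero hab hzH hup2 hd)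
  push_cast at d1 d2
  refine false_of_det_eq_zero (F := ZMod p) (w₂₁ := w₂₁) (i := i) (j := j) (r := r) (s := s)
    (t := t) hw ?_ (by linear_combination d1) (by linear_combination d2)
  rintro ⟨e1, e2⟩
  have h2 : cxPow p a b (i * s - j * r) (j * t) = cxPow p a b 0 0 :=
    hS.cxPow_congr (by push_cast; exact e1) (by push_cast; exact e2)
  rw [h2, cxPow, zpow_zero, zpow_zero, one_mul, one_mul] at hz
  exact huv hz

/-- The witnesses are `u = a ^ i b` and `v = a ^ p c ^ l`, with `[u, v]` of coordinates `(-1, l)`.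
The two equations say that `v ^ p` and `u ^ (p ^ 2)` are powers of `[u, v]`, so `⟨u, v⟩` has order
at most `p ^ 4` in a group of order `p ^ 7`. -/
theorem exists_three_le_mem_a1IndexExponents {l i : ℤ}
    (h1 : (l : ZMod p) ^ 2 + l * w₁₁ + w₁₂ = 0) (h2 : (w₂₂ : ZMod p) + l * w₂₁ = i * l ^ 2) :
    ∃ k ∈ a1IndexExponents p G, 3 ≤ k := by
  have := hS.finite
  have hp : p.Prime := Fact.out
  set u := a ^ i * b ^ (1 : ℤ) * (⁅a, b⁆ ^ (0 : ℤ) * ⁅b, ⁅a, b⁆⁆ ^ (0 : ℤ)) with hu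
  set v := (a ^ p) ^ (1 : ℤ) * (b ^ p) ^ (0 : ℤ) * ⁅a, b⁆ ^ l * cxPow p a b 0 0 with hv
  have hz := hS.semiconjBy_word hab hodd i 1 0 0 1 0 l 0 0
  rw [← hu, ← hv] at hz
  have hz' : ⁅u, v⁆ = cxPow p a b (-1) l := by
    rw [commutatorElement_def, hz.eq]
    have e1 : i * 0 - 1 * 1 = (-1 : ℤ) := by ring
    rw [e1, one_mul]
    group
  have hcen := Subgroup.mem_center_iff.1 (hS.cxPow_mem_center (a := a) (b := b) (-1) l)
  have hvp : v ^ p = ⁅u, v⁆ ^ (-(w₁₁ + l)) := by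
    rw [hS.word_pow hab hodd, ha, hb, hz', hS.cxPow_zpow, hS.cxPow_zpow, hS.cxPow_zpow,
      hS.cxPow_mul, hS.cxPow_mul]
    refine hS.cxPow_congr ?_ ?_
    · push_cast; ring
    · push_cast; linear_combination h1
  have hup : u ^ p ^ 2 = ⁅u, v⁆ ^ (-(w₁₁ * i + w₂₁)) := by
    rw [hS.word_pow_sq hab hodd i 1 (by simp), ha, hb, hz', hS.cxPow_zpow, hS.cxPow_zpow,
      hS.cxPow_zpow, hS.cxPow_mul]
    refine hS.cxPow_congr ?_ ?_
    · push_cast; ring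
    · push_cast; linear_combination i * h1 + h2
  have hne : ⁅u, v⁆ ≠ 1 := by
    intro h
    rw [hz'] at h
    have := hS.dvd_of_cxPow_eq_one hab h
    rw [dvd_neg] at this
    exact (Nat.prime_iff_prime_int.1 hp).not_isUnit (isUnit_of_dvd_one this)
  have hpow : ⁅u, v⁆ ^ p = 1 := by
    rw [hz']
    exact hS.pow_eq_one _ (hS.cxPow_mem _ _)
  have hcu : Commute ⁅u, v⁆ u := by rw [hz']; exact (hcen u).symm
  have hcv : Commute ⁅u, v⁆ v := by rw [hz']; exact (hcen v).symm
  obtain ⟨k, hk⟩ := hS.isPGroup.index (Subgroup.closure {u, v})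
  refine ⟨k, ⟨_, isMinimalNonabelian_closure_pair hS.isPGroup hcu hcv hne hpow, hk⟩, ?_⟩
  have hcard := card_closure_pair_le (u := u) (v := v) (z := ⁅u, v⁆)
    (by rw [commutatorElement_def]; group) hcu hcv (pow_pos hp.pos 2) hp.pos hp.pos
    (hup ▸ zpow_mem (Subgroup.mem_zpowers _) _) (hvp ▸ zpow_mem (Subgroup.mem_zpowers _) _) hpow
  have h3 := Nat.mul_le_mul_right (p ^ k) hcard
  rw [← hk, Subgroup.card_mul_index, hS.card_eq, hk] at h3
  have e : p ^ 2 * p * p * p ^ k = p ^ (4 + k) := by ring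
  rw [e, Nat.pow_le_pow_iff_right hp.one_lt] at h3
  omega

end IsMExtension

/-! ### The main theorem. -/

theorem theorem5p1 (p n m : ℕ) [Fact p.Prime] (hp : Odd p) (hm : 2 ≤ m) (hmn : m ≤ n)
    (G : Type*) [Group G] [Finite G] (hG : IsPGroup p G)
    (hG3 : Nonempty (G3 G ≃* Multiplicative (ZMod p)))
    (hK : Nonempty (phiG3 G ≃* Multiplicative (ZMod p × ZMod p)))
    (hM : Nonempty ((G ⧸ phiG3 G) ≃* MGroup p n m))
    (hC : Nonempty ((centDerived G ⧸ (phiG3 G).subgroupOf (centDerived G)) ≃*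
      Multiplicative (ZMod (p ^ n) × ZMod (p ^ (m - 1)) × ZMod p))) :
    (2 ≤ iMin p G ∧ ¬ ∃ H : Subgroup G, IsMinimalNonabelian H ∧ H.index = p) ∧
    n ≤ iMax p G ∧
    ∀ (a b : G) (w : Matrix (Fin 2) (Fin 2) (ZMod p)), IsCharacteristicMatrix p n m a b w →
      (iMax p G = 2 ↔
        (n = 2 ∧ m = 2) ∧
          ((w 0 0 = 0 ∧ w 0 1 = 0 ∧ w 1 1 ≠ 0) ∨
            ¬ IsSquare ((w 0 0) ^ 2 - 4 * w 0 1))) := by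
  have hpp : p.Prime := Fact.out
  have hS := isMExtension hp hm hmn hG hG3 hK hM hC
  have hcent := not_isMinimalNonabelian_centDerived hm (by omega) hC
  have htwo : ∀ k ∈ a1IndexExponents p G, 2 ≤ k :=
    fun k hk => hS.two_le_of_mem_a1IndexExponents hm hcent hk
  obtain ⟨k₀, hk₀, hnk₀⟩ := hS.exists_mem_a1IndexExponents
  have hn : n ≤ iMax p G := hnk₀.trans (hS.le_iMax hk₀)
  -- The witness `k₀` matters here: `sInf` of the empty set of naturals is `0`.
  refine ⟨⟨le_csInf ⟨k₀, hk₀⟩ htwo, ?_⟩, hn, ?_⟩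
  · rintro ⟨H, hH, hind⟩
    have := htwo 1 ⟨H, hH, by rw [hind, pow_one]⟩
    omega
  rintro a b w ⟨hab, hac, hx, hwa, hwb⟩
  have hchar : IsCharPair a b := ⟨hab, commutatorElement_eq_one_iff_commute.1 hac, hx⟩
  have hcast : ∀ e f : ZMod p, ⁅a, b⁆ ^ (e.val * p) * ⁅b, ⁅a, b⁆⁆ ^ f.val =
      cxPow p a b (e.val : ℤ) (f.val : ℤ) := by
    intro e f
    rw [cxPow, zpow_natCast, zpow_natCast, mul_comm, pow_mul]
  have hval : ∀ e : ZMod p, (((e.val : ℕ) : ℤ) : ZMod p) = e := by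
    intro e
    rw [Int.cast_natCast, ZMod.natCast_zmod_val]
  constructor
  · intro h2
    obtain ⟨rfl, rfl⟩ : n = 2 ∧ m = 2 := by omega
    refine ⟨⟨rfl, rfl⟩, ?_⟩
    by_contra! hw
    rw [hcast] at hwa hwb
    have h2ne : (2 : ZMod p) ≠ 0 := by
      intro h
      have h' : ((2 : ℕ) : ZMod p) = 0 := by exact_mod_cast h
      rw [ZMod.natCast_eq_zero_iff, Nat.prime_dvd_prime_iff_eq hpp Nat.prime_two] at h'
      rw [h'] at hp
      exact absurd hp (by decide)
    obtain ⟨l, i, h3, h4⟩ := exists_root_of_isSquare h2ne (w₂₁ := w 1 0)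
      (fun h => h.2.2 (hw.1 h.1 h.2.1)) hw.2
    obtain ⟨k, hk, hk3⟩ := hS.exists_three_le_mem_a1IndexExponents hchar hp hwa hwb
      (l := l.val) (i := i.val) (by simpa only [hval] using h3) (by simpa only [hval] using h4)
    have := hS.le_iMax hk
    omega
  · rintro ⟨⟨rfl, rfl⟩, hw⟩
    refine le_antisymm (csSup_le ⟨k₀, hk₀⟩ ?_) hn
    rintro k hk
    have hk2 := htwo k hk
    obtain ⟨H, hH, hind⟩ := hk
    obtain ⟨x, y, hxy⟩ := hH.1
    rw [hcast] at hwa hwb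
    have hcard := hS.pow_five_le_card_of_ne_top hchar hp hwa hwb (by simpa only [hval] using hw)
      (H := H) (by
        rintro rfl
        rw [Subgroup.index_top] at hind
        have := Nat.one_lt_pow (by omega : k ≠ 0) hpp.one_lt
        omega) x.2 y.2 (fun h => hxy (Subtype.ext h))
    have h1 := Nat.mul_le_mul_right (p ^ k) hcard
    rw [← hind, H.card_mul_index, hS.card_eq, hind, ← pow_add,
      Nat.pow_le_pow_iff_right hpp.one_lt] at h1
    omega
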